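/- **Theorem.** Let $d,p\in\mathbb N$. Let $\mathcal P_2(\mathbb R^d)$ be the set of Borel probability measures $\mu$ on $\mathbb R^d$ with $\int|x|^2\,\mu(dx)<\infty$ ($|\cdot|$ is the Euclidean norm), with the topology and the Borel $\sigma$-algebra of the 2-Wasserstein distance $$\mathcal W_2(\mu,\mu')=\Big(\inf_{\gamma}\int|x-y|^2\,\gamma(dx,dy)\Big)^{1/2},$$ where $\gamma$ runs over the couplings of $\mu$ and $\mu'$. For a measurable function $f$ on $\mathbb R^d$ with values in a Euclidean space and $\mu\in\mathcal P_2(\mathbb R^d)$, write $|f|_\mu^2=\int|f(x)|^2\,\mu(dx)\in[0,\infty]$, and $\langle f,\mu\rangle=\int f(x)\,\mu(dx)$ when $f$ is $\mu$-integrable. Let $\sigma:\mathbb R\to\mathbb R$ be an activation function that is continuous, not affine, and satisfies $|\sigma(s)-\sigma(t)|\le C(1+|s-t|)$ for all $s,t\in\mathbb R$ and some constant $C$ (for example, $\sigma$ continuous, bounded and nonconstant, such as $\tanh$; or $\sigma$ Lipschitz and not affine, such as ReLU). A neural network from $\mathbb R^n$ into $\mathbb R^m$ is a function computed by a feedforward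 network with finitely many hidden layers of arbitrary finite widths: each hidden layer is $x\mapsto\sigma(Ax+b)$, with $\sigma$ applied to each coordinate, and the output layer is $x\mapsto Ax+b$. Let $\nu$ be a Borel probability measure on $\mathcal P_2(\mathbb R^d)$, and let $V:\mathbb R^d\times\mathcal P_2(\mathbb R^d)\to\mathbb R^p$ be continuous with $$\int_{\mathcal P_2(\mathbb R^d)}|V(\cdot,\mu)|_\mu^2\,\nu(d\mu)<\infty.$$ Then for every $\varepsilon>0$ there exist $k\in\mathbb N$, a neural network $\Psi$ from $\mathbb R^d\times\mathbb R^k$ into $\mathbb R^p$ and a neural network $\varphi$ from $\mathbb R^d$ into $\mathbb R^k$ such that $\varphi$ is $\mu$-integrable for every $\mu\in\mathcal P_2(\mathbb R^d)$ and $$\int_{\mathcal P_2(\mathbb R^d)}\big|V(\cdot,\mu)-\Psi(\cdot,\langle\varphi,\mu\rangle)\big|_\mu^2\,\nu(d\mu)\le\varepsilon.$$ -/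

import Mathlib

open MeasureTheory
open scoped ENNReal Matrix

noncomputable section

namespace MeanField

/-- The Euclidean space `ℝⁿ`, with its Euclidean norm. -/
abbrev Vec (n : ℕ) : Type := EuclideanSpace ℝ (Fin n)

/-- Square integrable Borel probability measures on `ℝᵈ`. -/
structure P2 (d : ℕ) where
  /-- the underlying measure -/
  toMeasure : Measure (Vec d)
  isProbabilityMeasure : IsProbabilityMeasure toMeasure
  secondMoment_lt_top : ∫⁻ x, ‖x‖ₑ ^ 2 ∂toMeasure < ∞

/-- `γ` is a coupling of `μ` and `μ'`: a measure on `ℝᵈ × ℝᵈ` with these two marginals. -/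
def IsCoupling {d : ℕ} (μ μ' : P2 d) (γ : Measure (Vec d × Vec d)) : Prop :=
  γ.map Prod.fst = μ.toMeasure ∧ γ.map Prod.snd = μ'.toMeasure

/-- The 2-Wasserstein distance
`W₂(μ, μ') = (inf over couplings γ of ∫ |x - y|² γ(dx, dy)) ^ (1/2)`.
It is written with values in `[0, ∞]`, and is finite on `P2 d`. -/
def W2 {d : ℕ} (μ μ' : P2 d) : ℝ≥0∞ :=
  (⨅ (γ : Measure (Vec d × Vec d)) (_ : IsCoupling μ μ' γ),
    ∫⁻ z, ‖z.1 - z.2‖ₑ ^ 2 ∂γ) ^ (1 / 2 : ℝ)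

/-- The topology of the distance `W₂`: a set is open iff it contains a `W₂`-ball of positive
radius around each of its points. -/
instance (d : ℕ) : TopologicalSpace (P2 d) where
  IsOpen U := ∀ μ ∈ U, ∃ r : ℝ≥0∞, 0 < r ∧ ∀ μ' : P2 d, W2 μ μ' < r → μ' ∈ U
  isOpen_univ := fun _ _ => ⟨1, one_pos, fun _ _ => trivial⟩
  isOpen_inter := by
    intro U U' hU hU' μ hμ
    obtain ⟨r, hr, h⟩ := hU μ hμ.1
    obtain ⟨r', hr', h'⟩ := hU' μ hμ.2
    exact ⟨min r r', lt_min hr hr', fun μ' hd =>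
      ⟨h μ' (hd.trans_le (min_le_left _ _)), h' μ' (hd.trans_le (min_le_right _ _))⟩⟩
  isOpen_sUnion := by
    intro S hS μ hμ
    obtain ⟨U, hU, hμU⟩ := hμ
    obtain ⟨r, hr, h⟩ := hS U hU μ hμU
    exact ⟨r, hr, fun μ' hd => ⟨U, hU, h μ' hd⟩⟩

/-- The Borel σ-algebra of the distance `W₂`. -/
instance (d : ℕ) : MeasurableSpace (P2 d) := borel (P2 d)

instance (d : ℕ) : BorelSpace (P2 d) := ⟨rfl⟩

/-- The parameters (weight matrices and biases) of a feedforward neural network with `n` inputs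
and `m` outputs, with any number of hidden layers of any widths. -/
inductive Network : ℕ → ℕ → Type
  /-- the affine output layer -/
  | output {n m : ℕ} (A : Matrix (Fin m) (Fin n) ℝ) (b : Fin m → ℝ) : Network n m
  /-- a hidden layer of width `l`, followed by the remaining layers -/
  | hidden {n l m : ℕ} (A : Matrix (Fin l) (Fin n) ℝ) (b : Fin l → ℝ) (rest : Network l m) :
      Network n m

/-- The function `ℝⁿ → ℝᵐ` computed by a feedforward network with activation function `σ`:
the output layer is `x ↦ A x + b`, and a hidden layer is `x ↦ σ(A x + b)`, with `σ` applied to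
each coordinate. -/
def Network.eval (σ : ℝ → ℝ) : {n m : ℕ} → Network n m → Vec n → Vec m
  | _, _, .output A b, x => WithLp.toLp 2 (A *ᵥ x.ofLp + b)
  | _, _, .hidden A b rest, x =>
      rest.eval σ (WithLp.toLp 2 fun i => σ ((A *ᵥ x.ofLp + b) i))

/-- The identification of `ℝᵈ × ℝᵏ` with `ℝᵈ⁺ᵏ`. -/
def join {d k : ℕ} (x : Vec d) (y : Vec k) : Vec (d + k) :=
  WithLp.toLp 2 (Fin.append x.ofLp y.ofLp)

/-- The bracket `⟨f, μ⟩ = ∫ f(x) μ(dx) ∈ ℝᵏ`, for integrable `f`. -/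
def bracket {d k : ℕ} (f : Vec d → Vec k) (μ : P2 d) : Vec k :=
  ∫ x, f x ∂μ.toMeasure

/-- `|f|²_μ = ∫ |f(x)|² μ(dx)`, in `[0, ∞]`. -/
def sqNorm {d p : ℕ} (f : Vec d → Vec p) (μ : P2 d) : ℝ≥0∞ :=
  ∫⁻ x, ‖f x‖ₑ ^ 2 ∂μ.toMeasure

/-- The admissible activation functions: continuous, not affine, and with
`|σ(s) - σ(t)| ≤ C (1 + |s - t|)`. Every continuous bounded nonconstant function (such as `tanh`)
and every Lipschitz function that is not affine (such as ReLU) is one. -/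
structure IsActivation (σ : ℝ → ℝ) : Prop where
  continuous : Continuous σ
  not_affine : ¬ ∃ a b : ℝ, ∀ t, σ t = a * t + b
  growth : ∃ C : ℝ, ∀ s t, |σ s - σ t| ≤ C * (1 + |s - t|)

end MeanField

end

/-!
All approximations take place in `L²(M)`, where `M = ν ⊗ₘ ker d` is the measure `ν(dμ) μ(dx)` on
`P2 d × ℝᵈ`: the square of the `L²(M)` norm of `(μ, x) ↦ F x μ` is the integral of `|F(·, μ)|²_μ`.

*Networks are dense in `L²(m)` for each finite measure `m` on `ℝⁿ`*
(`exists_network_eLpNorm_sub_le`). By the growth condition `τ s = σ (s + h) - σ s` is bounded, and it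
is not constant for some `h`, since otherwise `σ` would be affine. Smoothing `τ` and differentiating
`t ↦ τ (t ⟪a, x⟫ + b)` at `t = 0` gives all powers of `⟪a, x⟫`, hence the exponentials
`exp ⟪a, x⟫`, and the Stone-Weierstrass theorem gives uniform approximation on compact sets
(`exists_shallow_norm_sub_le`). To control the error outside of a compact set, a second hidden layer
truncates the output.

*The Borel σ-algebra of `W₂` is generated by the evaluations `μ ↦ μ A`*
(`measurableSpace_le_comap`). If `ℝᵈ` is cut into small cells, then two measures with almost the same
masses in finitely many cells, and small second moments outside of them, have a coupling of small
cost: within each cell, the mass that they share is coupled. Countably many masses and tail moments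
therefore determine the Wasserstein neighbourhoods, and each open set is the preimage of an open set
under these countably many measurable functionals. This takes the place of the separability of the
Wasserstein space.

*Conclusion.* By the second fact, `V` is close in `L²(M)` to a measurable function, hence to a
continuous function `G` with compact support, of `x` and of finitely many masses `μ (A i)`
(`exists_comp_masses_eLpNorm_sub_le`). The indicator functions of the sets `A i` are approximated by a
network `φ` in `L²` of the mixture `∫ μ ν(dμ)`, which by Jensen's inequality makes `⟨φ, μ⟩` close to
the masses in `L²(ν)`, and `G` is uniformly continuous (`exists_network_bracket`). Finally `G` is
approximated by a network `Ψ` in `L²` of the law of `(x, ⟨φ, μ⟩)` under `M`.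
-/

namespace MeanField

open Filter Topology Convolution

/-! ### One-dimensional density -/

/-- A closed subspace contains the Bochner integral of a function with values in it. -/
theorem integral_mem_of_isClosed {α E : Type*} [MeasurableSpace α] {μ : Measure α}
    [NormedAddCommGroup E] [NormedSpace ℝ E] [CompleteSpace E] (W : Submodule ℝ E)
    (hW : IsClosed (W : Set E)) (f : α → E) (hf : Integrable f μ) (hfW : ∀ x, f x ∈ W) :
    ∫ x, f x ∂μ ∈ W := by
  have : IsClosed (W : Set E) := hW
  have h := (W.mkQL).integral_comp_comm hf
  have h0 : ∀ x, W.mkQL (f x) = 0 := fun x => by simpa using hfW x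
  simp only [h0, integral_zero] at h
  simpa using h.symm

/-- If `g 0` is nonconstant and bounded together with all its derivatives `g 1, g 2, …`, then none of
these vanishes identically: a function with constant derivative `c ≠ 0` is unbounded. -/
theorem exists_derivative_ne_zero (g : ℕ → ℝ → ℝ)
    (hg : ∀ k y, HasDerivAt (g k) (g (k + 1) y) y) (C : ℕ → ℝ) (hC : ∀ k y, |g k y| ≤ C k)
    (hne : ∃ y₁ y₂, g 0 y₁ ≠ g 0 y₂) (k : ℕ) : ∃ y, g k y ≠ 0 := by
  have key : ∀ k, ∃ y₁ y₂, g k y₁ ≠ g k y₂ := by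
    intro k
    induction k with
    | zero => exact hne
    | succ k ih =>
      by_contra! hc
      obtain ⟨y₁, y₂, h⟩ := ih
      set c := g (k + 1) 0 with hcdef
      have hd : ∀ y, HasDerivAt (fun y => g k y - c * y) 0 y := fun y => by
        have h2 : HasDerivAt (fun y => g k y - c * y) (g (k + 1) y - c * 1) y :=
          (hg k y).sub ((hasDerivAt_id y).const_mul c)
        rw [hc y 0] at h2
        simpa [← hcdef] using h2
      have hconst : ∀ y, g k y - c * y = g k 0 := fun y => by
        have := is_const_of_deriv_eq_zero (fun y => (hd y).differentiableAt)
          (fun y => (hd y).deriv) y 0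
        simpa using this
      have hc0 : c = 0 := by
        by_contra hc0
        have h1 := hC k ((2 * C k + 1) / c)
        have h2 := hconst ((2 * C k + 1) / c)
        have h3 := hC k 0
        rw [mul_div_cancel₀ _ hc0] at h2
        rw [abs_le] at h1 h3
        linarith
      apply h
      have h1 := hconst y₁
      have h2 := hconst y₂
      rw [hc0] at h1 h2
      linarith
  obtain ⟨y₁, y₂, h⟩ := key k
  by_contra! hc
  exact h (by rw [hc, hc])

/-- The smoothing of a bounded continuous nonconstant function by a bump function of small support:
it is nonconstant and has bounded derivatives of all orders. -/
theorem exists_mollifier (τ : ℝ → ℝ) (hτ : Continuous τ) (B : ℝ) (hB : ∀ t, |τ t| ≤ B)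
    (hne : ∃ s t, τ s ≠ τ t) :
    ∃ (φ : ℝ → ℝ) (g : ℕ → ℝ → ℝ) (C : ℕ → ℝ), Continuous φ ∧ HasCompactSupport φ ∧
      (∀ y, g 0 y = ∫ v, φ v * τ (y - v)) ∧
      (∀ k y, HasDerivAt (g k) (g (k + 1) y) y) ∧ (∀ k y, |g k y| ≤ C k) ∧
      ∃ y₁ y₂, g 0 y₁ ≠ g 0 y₂ := by
  obtain ⟨s, t, hst⟩ := hne
  set ε := dist (τ s) (τ t) / 3 with hε
  have hε0 : 0 < ε := by have := dist_pos.2 hst; positivity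
  obtain ⟨r₁, hr₁, h₁⟩ := Metric.continuousAt_iff.1 (hτ.continuousAt (x := s)) ε hε0
  obtain ⟨r₂, hr₂, h₂⟩ := Metric.continuousAt_iff.1 (hτ.continuousAt (x := t)) ε hε0
  have hr : 0 < min r₁ r₂ := lt_min hr₁ hr₂
  let ψ : ContDiffBump (0 : ℝ) := ⟨min r₁ r₂ / 2, min r₁ r₂, by positivity, by linarith⟩
  set φ : ℝ → ℝ := ψ.normed volume
  have hφs : ContDiff ℝ (⊤ : ℕ∞) φ := ψ.contDiff_normed
  have hφc : HasCompactSupport φ := ψ.hasCompactSupport_normed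
  have hks : ∀ k, ContDiff ℝ (⊤ : ℕ∞) (iteratedDeriv k φ) := fun k => by
    rw [iteratedDeriv_eq_iterate]
    exact hφs.iterate_deriv k
  have hkc : ∀ k, HasCompactSupport (iteratedDeriv k φ) := fun k => by
    induction k with
    | zero => simpa using hφc
    | succ k ih => rw [iteratedDeriv_succ]; exact ih.deriv
  let L := ContinuousLinearMap.lsmul ℝ ℝ (E := ℝ)
  have hli : LocallyIntegrable τ := hτ.locallyIntegrable
  have hconv : ∀ k y, (iteratedDeriv k φ ⋆[L, volume] τ) y = ∫ v, iteratedDeriv k φ v * τ (y - v) :=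
    fun k y => by simp [convolution_def, L]
  refine ⟨φ, fun k => iteratedDeriv k φ ⋆[L, volume] τ,
    fun k => ∫ v, ‖iteratedDeriv k φ v‖ * B, hφs.continuous, hφc, fun y => ?_, fun k y => ?_,
    fun k y => ?_, s, t, ?_⟩
  · simpa using hconv 0 y
  · beta_reduce
    rw [iteratedDeriv_succ]
    exact (hkc k).hasDerivAt_convolution_left L ((hks k).of_le (by simp)) hli y
  · beta_reduce
    rw [hconv, ← Real.norm_eq_abs]
    refine norm_integral_le_of_norm_le
      (((hks k).continuous.integrable_of_hasCompactSupport (hkc k)).norm.mul_const B)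
      (Eventually.of_forall fun v => ?_)
    rw [norm_mul]
    gcongr
    exact hB _
  · have e₁ := ψ.dist_normed_convolution_le (μ := volume) (g := τ) (x₀ := s) (ε := ε)
      hτ.aestronglyMeasurable (fun x hx => (h₁ (lt_of_lt_of_le hx (min_le_left _ _))).le)
    have e₂ := ψ.dist_normed_convolution_le (μ := volume) (g := τ) (x₀ := t) (ε := ε)
      hτ.aestronglyMeasurable (fun x hx => (h₂ (lt_of_lt_of_le hx (min_le_right _ _))).le)
    intro heq
    simp only [iteratedDeriv_zero] at heq
    rw [show (φ ⋆[L, volume] τ) s = (φ ⋆[L, volume] τ) t from heq] at e₁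
    have := dist_triangle_left (τ s) (τ t) ((φ ⋆[L, volume] τ) t)
    have h3 : dist (τ s) (τ t) = 3 * ε := by rw [hε]; ring
    have e₁' : dist ((φ ⋆[L, volume] τ) t) (τ s) ≤ ε := e₁
    have e₂' : dist ((φ ⋆[L, volume] τ) t) (τ t) ≤ ε := e₂
    linarith

/-- The function `x ↦ f (t * u x + b)` on a compact space. -/
def ridge {X : Type*} [TopologicalSpace X] (f : C(ℝ, ℝ)) (u : C(X, ℝ)) (t b : ℝ) : C(X, ℝ) :=
  f.comp (t • u + ContinuousMap.const X b)

@[simp] theorem ridge_apply {X : Type*} [TopologicalSpace X] (f : C(ℝ, ℝ)) (u : C(X, ℝ)) (t b : ℝ)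
    (x : X) : ridge f u t b x = f (t * u x + b) := by
  simp [ridge]

theorem abs_taylor_one_le (h h' : ℝ → ℝ) (C : ℝ) (hh : ∀ y, HasDerivAt h (h' y) y)
    (hL : ∀ y z, |h' y - h' z| ≤ C * |y - z|) (y z : ℝ) :
    |h (y + z) - h y - z * h' y| ≤ C * |z| * |z| := by
  have hd : ∀ w ∈ Set.uIcc 0 z, HasDerivWithinAt (fun w => h (y + w) - w * h' y)
      (h' (y + w) - h' y) (Set.uIcc 0 z) w := fun w _ => by
    have h1 : HasDerivAt (fun w => h (y + w)) (h' (y + w)) w := by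
      simpa using (hh (y + w)).comp_const_add y w
    have h2 : HasDerivAt (fun w => w * h' y) (h' y) w := by
      simpa using (hasDerivAt_id w).mul_const (h' y)
    exact (h1.sub h2).hasDerivWithinAt
  have hC : 0 ≤ C := by simpa using (abs_nonneg _).trans (hL 1 0)
  have hb : ∀ w ∈ Set.uIcc 0 z, ‖h' (y + w) - h' y‖ ≤ C * |z| := fun w hw => by
    refine (hL _ _).trans ?_
    have : |w| ≤ |z| := by simpa using Set.abs_sub_left_of_mem_uIcc hw
    simpa using mul_le_mul_of_nonneg_left this hC
  have := (convex_uIcc 0 z).norm_image_sub_le_of_norm_hasDerivWithin_le hd hb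
    Set.left_mem_uIcc Set.right_mem_uIcc
  simp only [Real.norm_eq_abs, add_zero, zero_mul, sub_zero] at this
  rwa [show h (y + z) - h y - z * h' y = h (y + z) - z * h' y - h y by ring]

/-- The curve `t ↦ f (t u + b)` in `C(X, ℝ)` has derivative `u * f' (t u + b)`. -/
theorem hasDerivAt_ridge {X : Type*} [TopologicalSpace X] [CompactSpace X] (f f' : C(ℝ, ℝ))
    (C : ℝ) (hf : ∀ y, HasDerivAt f (f' y) y) (hL : ∀ y z, |f' y - f' z| ≤ C * |y - z|)
    (u : C(X, ℝ)) (t b : ℝ) :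
    HasDerivAt (fun t => ridge f u t b) (u * ridge f' u t b) t := by
  have hC : 0 ≤ C := by simpa using (abs_nonneg _).trans (hL 1 0)
  rw [hasDerivAt_iff_isLittleO]
  have hO : (fun t' => ridge f u t' b - ridge f u t b - (t' - t) • (u * ridge f' u t b))
      =O[𝓝 t] fun t' => (t' - t) * (t' - t) := by
    refine Asymptotics.IsBigO.of_bound (C * ‖u‖ * ‖u‖) (Eventually.of_forall fun t' => ?_)
    rw [ContinuousMap.norm_le _ (by positivity)]
    intro x
    have h1 := abs_taylor_one_le f f' C hf hL (t * u x + b) ((t' - t) * u x)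
    have h2 : |u x| ≤ ‖u‖ := u.norm_coe_le_norm x
    have h3 : (ridge f u t' b - ridge f u t b - (t' - t) • (u * ridge f' u t b)) x
        = f (t * u x + b + (t' - t) * u x) - f (t * u x + b) - (t' - t) * u x * f' (t * u x + b) := by
      simp only [ContinuousMap.coe_sub, ContinuousMap.coe_smul, ContinuousMap.coe_mul,
        Pi.sub_apply, Pi.smul_apply, Pi.mul_apply, ridge_apply, smul_eq_mul]
      rw [show t * u x + b + (t' - t) * u x = t' * u x + b by ring]
      ring
    rw [h3, Real.norm_eq_abs]
    refine h1.trans ?_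
    rw [abs_mul, norm_mul, Real.norm_eq_abs]
    calc C * (|t' - t| * |u x|) * (|t' - t| * |u x|)
        ≤ C * (|t' - t| * ‖u‖) * (|t' - t| * ‖u‖) := by gcongr
      _ = _ := by ring
  refine hO.trans_isLittleO ?_
  have : (fun t' => (t' - t) * (t' - t)) =o[𝓝 t] fun t' => 1 * (t' - t) := by
    refine Asymptotics.IsLittleO.mul_isBigO ?_ (Asymptotics.isBigO_refl _ _)
    rw [Asymptotics.isLittleO_one_iff]
    exact tendsto_sub_nhds_zero_iff.2 tendsto_id
  simpa using this

/-- All powers of `u` lie in the closed span of the functions `τ (t u + b)`: after smoothing `τ`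
to `g`, the `k`-th derivative of `t ↦ g (t u + b)` at `t = 0` is `g⁽ᵏ⁾(b) u ^ k`. -/
theorem pow_mem_of_ridge_mem {X : Type*} [TopologicalSpace X] [CompactSpace X] (τ : C(ℝ, ℝ))
    (B : ℝ) (hB : ∀ t, |τ t| ≤ B) (hne : ∃ s t, τ s ≠ τ t) (u : C(X, ℝ))
    (W : Submodule ℝ C(X, ℝ)) (hW : IsClosed (W : Set C(X, ℝ)))
    (hτW : ∀ t b, ridge τ u t b ∈ W) (k : ℕ) : u ^ k ∈ W := by
  obtain ⟨φ, g, C, hφ, hφc, hg0, hg, hC, hgne⟩ := exists_mollifier τ τ.continuous B hB hne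
  have hgc : ∀ k, Continuous (g k) := fun k =>
    continuous_iff_continuousAt.2 fun y => (hg k y).continuousAt
  have hL : ∀ k y z, |g k y - g k z| ≤ C (k + 1) * |y - z| := fun k y z => by
    have := convex_univ.norm_image_sub_le_of_norm_hasDerivWithin_le
      (fun w _ => (hg k w).hasDerivWithinAt) (fun w _ => hC (k + 1) w) (Set.mem_univ z)
      (Set.mem_univ y)
    simpa using this
  let G : ℕ → C(ℝ, ℝ) := fun k => ⟨g k, hgc k⟩
  -- The smoothed ridge functions are integrals of translates of the original ones.
  have h0 : ∀ t b, ridge (G 0) u t b ∈ W := by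
    intro t b
    let F : ℝ → C(X, ℝ) := fun v => φ v • ridge τ u t (b - v)
    have hFc : Continuous F := by
      refine hφ.smul ?_
      let H : C(ℝ × X, ℝ) := ⟨fun q => τ (t * u q.2 + (b - q.1)), by fun_prop⟩
      have : (fun v => ridge τ u t (b - v)) = H.curry := by
        ext v x; simp [H]
      rw [this]
      exact H.curry.continuous
    have hFi : Integrable F :=
      hFc.integrable_of_hasCompactSupport hφc.smul_right
    have hmem := integral_mem_of_isClosed W hW F hFi (fun v => W.smul_mem _ (hτW t (b - v)))
    have : ridge (G 0) u t b = ∫ v, F v := by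
      ext x
      have h1 := (ContinuousMap.evalCLM ℝ x).integral_comp_comm hFi
      rw [show (∫ v, F v) x = ContinuousMap.evalCLM ℝ x (∫ v, F v) from rfl, ← h1, ridge_apply]
      change g 0 _ = _
      rw [hg0]
      congr 1
      ext v
      simp [F, add_sub_assoc]
    rwa [this]
  have hk : ∀ k t b, u ^ k * ridge (G k) u t b ∈ W := by
    intro k
    induction k with
    | zero => simpa using h0
    | succ k ih =>
      intro t b
      have hd : HasDerivAt (fun t => u ^ k * ridge (G k) u t b)
          (u ^ k * (u * ridge (G (k + 1)) u t b)) t :=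
        (hasDerivAt_ridge (G k) (G (k + 1)) (C (k + 2)) (hg k) (hL (k + 1)) u t b).const_mul _
      rw [pow_succ, mul_assoc]
      refine hW.mem_of_tendsto hd.tendsto_slope (Eventually.of_forall fun t' => ?_)
      rw [slope_def_module]
      exact W.smul_mem _ (W.sub_mem (ih t' b) (ih t b))
  -- At `t = 0` the second factor is the constant `g k b`, which is nonzero for a suitable `b`.
  obtain ⟨b, hb⟩ := exists_derivative_ne_zero g hg C hC hgne k
  have h1 := W.smul_mem (g k b)⁻¹ (hk k 0 b)
  convert h1 using 1
  ext x
  simp only [ContinuousMap.coe_smul, ContinuousMap.coe_mul, Pi.smul_apply, Pi.mul_apply,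
    ridge_apply, smul_eq_mul, zero_mul, zero_add, ContinuousMap.coe_pow, Pi.pow_apply]
  change _ = (g k b)⁻¹ * (u x ^ k * g k b)
  field_simp

/-! ### Uniform approximation on compact sets by networks with one hidden layer -/

/-- The exponential of a function all of whose powers lie in a closed subspace lies there too. -/
theorem exp_mem_of_pow_mem {X : Type*} [TopologicalSpace X] [CompactSpace X] (u : C(X, ℝ))
    (W : Submodule ℝ C(X, ℝ)) (hW : IsClosed (W : Set C(X, ℝ))) (h : ∀ k, u ^ k ∈ W) :
    NormedSpace.exp u ∈ W :=
  hW.mem_of_tendsto (NormedSpace.exp_series_hasSum_exp' (𝕂 := ℝ) u)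
    (Eventually.of_forall fun _ => W.sum_mem fun k _ => W.smul_mem _ (h k))

theorem exp_apply_continuousMap {X : Type*} [TopologicalSpace X] [CompactSpace X] (u : C(X, ℝ))
    (x : X) : NormedSpace.exp u x = Real.exp (u x) := by
  have h := NormedSpace.map_exp (ContinuousMap.evalAlgHom ℝ ℝ x)
    (continuous_eval_const x) u
  rw [Real.exp_eq_exp_ℝ]
  exact h

/-- The linear functional `x ↦ ⟪a, x⟫`, restricted to `K`. -/
noncomputable def innerOn {n : ℕ} (K : Set (Vec n)) (a : Vec n) : C(K, ℝ) :=
  ⟨fun x => inner ℝ a (x : Vec n), by fun_prop⟩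

/-- Ridge functions `x ↦ τ (⟪a, x⟫ + b)` span a dense subspace of `C(K, ℝ)`: its closure contains
the exponentials `x ↦ exp ⟪a, x⟫`, whose span is an algebra that separates points. -/
theorem ridge_dense {n : ℕ} (K : Set (Vec n)) [CompactSpace K] (τ : C(ℝ, ℝ))
    (B : ℝ) (hB : ∀ t, |τ t| ≤ B) (hne : ∃ s t, τ s ≠ τ t) :
    (Submodule.span ℝ {f : C(K, ℝ) | ∃ a b, f = ridge τ (innerOn K a) 1 b}).topologicalClosure
      = ⊤ := by
  set W := (Submodule.span ℝ
    {f : C(K, ℝ) | ∃ a b, f = ridge τ (innerOn K a) 1 b}).topologicalClosure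
  have hW : IsClosed (W : Set C(K, ℝ)) := Submodule.isClosed_topologicalClosure _
  have hexp : ∀ a, NormedSpace.exp (innerOn K a) ∈ W := fun a => by
    refine exp_mem_of_pow_mem _ W hW (pow_mem_of_ridge_mem τ B hB hne _ W hW fun t b => ?_)
    refine Submodule.le_topologicalClosure _ (Submodule.subset_span ⟨t • a, b, ?_⟩)
    ext x
    simp [innerOn, inner_smul_left]
  let S : Submonoid C(K, ℝ) :=
    { carrier := {f | ∃ a, f = NormedSpace.exp (innerOn K a)}
      one_mem' := ⟨0, by ext x; simp [exp_apply_continuousMap, innerOn]⟩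
      mul_mem' := by
        rintro _ _ ⟨a, rfl⟩ ⟨b, rfl⟩
        refine ⟨a + b, ?_⟩
        ext x
        simp [exp_apply_continuousMap, innerOn, inner_add_left, Real.exp_add] }
  have hA : (Algebra.adjoin ℝ (S : Set C(K, ℝ))).topologicalClosure = ⊤ := by
    refine ContinuousMap.subalgebra_topologicalClosure_eq_top_of_separatesPoints _ ?_
    intro x y hxy
    refine ⟨_, ⟨NormedSpace.exp (innerOn K ((x : Vec n) - y)),
      Algebra.subset_adjoin ⟨_, rfl⟩, rfl⟩, ?_⟩
    intro h
    beta_reduce at h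
    rw [exp_apply_continuousMap, exp_apply_continuousMap] at h
    have h1 := Real.exp_injective h
    have h2 : inner ℝ ((x : Vec n) - y) ((x : Vec n) - y) = 0 := by
      rw [inner_sub_right]
      exact sub_eq_zero.2 h1
    rw [inner_self_eq_zero, sub_eq_zero] at h2
    exact hxy (Subtype.ext h2)
  have hle : (Algebra.adjoin ℝ (S : Set C(K, ℝ)) : Set C(K, ℝ)) ⊆ W := by
    intro f hf
    have hf' : f ∈ Subalgebra.toSubmodule (Algebra.adjoin ℝ (S : Set C(K, ℝ))) := hf
    rw [Algebra.adjoin_eq_span, Submonoid.closure_eq] at hf'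
    refine Submodule.span_le.2 ?_ hf'
    rintro _ ⟨a, rfl⟩
    exact hexp a
  rw [eq_top_iff]
  intro f _
  have hf : f ∈ (Algebra.adjoin ℝ (S : Set C(K, ℝ))).topologicalClosure := by rw [hA]; trivial
  exact closure_minimal hle hW hf

/-- The functions `ℝⁿ → ℝᵐ` computed by networks with one hidden layer and activation function `τ`
(without output bias). -/
def shallow (τ : ℝ → ℝ) (n m : ℕ) : Submodule ℝ (Vec n → Vec m) :=
  Submodule.span ℝ {f | ∃ a b c, f = fun x => τ (inner ℝ a x + b) • c}

/-- Universal approximation on compact sets. -/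
theorem exists_shallow_norm_sub_le {n m : ℕ} {K : Set (Vec n)} (hK : IsCompact K) {τ : ℝ → ℝ}
    (hτ : Continuous τ) {B : ℝ} (hB : ∀ t, |τ t| ≤ B) (hne : ∃ s t, τ s ≠ τ t)
    {f : Vec n → Vec m} (hf : Continuous f) {ε : ℝ} (hε : 0 < ε) :
    ∃ g ∈ shallow τ n m, ∀ x ∈ K, ‖f x - g x‖ ≤ ε := by
  have : CompactSpace K := isCompact_iff_compactSpace.1 hK
  set S := Submodule.span ℝ {f : C(K, ℝ) | ∃ a b, f = ridge ⟨τ, hτ⟩ (innerOn K a) 1 b}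
  have hdense := ridge_dense K ⟨τ, hτ⟩ B hB hne
  have hext : ∀ s ∈ S, ∀ c : Vec m, ∃ g ∈ shallow τ n m, ∀ x : K, g x = s x • c := by
    intro s hs c
    induction hs using Submodule.span_induction with
    | mem s hs =>
      obtain ⟨a, b, rfl⟩ := hs
      exact ⟨_, Submodule.subset_span ⟨a, b, c, rfl⟩, fun x => by simp [innerOn]⟩
    | zero => exact ⟨0, Submodule.zero_mem _, fun x => by simp⟩
    | add s t _ _ hs ht =>
      obtain ⟨g, hg, hg'⟩ := hs
      obtain ⟨h, hh, hh'⟩ := ht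
      exact ⟨g + h, Submodule.add_mem _ hg hh, fun x => by simp [hg', hh', add_smul]⟩
    | smul r s _ hs =>
      obtain ⟨g, hg, hg'⟩ := hs
      exact ⟨r • g, Submodule.smul_mem _ _ hg, fun x => by simp [hg', mul_smul]⟩
  have hcoord : ∀ i : Fin m, ∃ g ∈ shallow τ n m, ∀ x ∈ K,
      ‖f x i • EuclideanSpace.single i (1 : ℝ) - g x‖ ≤ ε / (m + 1) := by
    intro i
    let fi : C(K, ℝ) := ⟨fun x => f x i, by fun_prop⟩
    have hfi : fi ∈ closure (S : Set C(K, ℝ)) := by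
      change fi ∈ S.topologicalClosure
      rw [hdense]; trivial
    obtain ⟨s, hs, hsd⟩ := Metric.mem_closure_iff.1 hfi (ε / (m + 1)) (by positivity)
    obtain ⟨g, hg, hgs⟩ := hext s hs (EuclideanSpace.single i 1)
    refine ⟨g, hg, fun x hx => ?_⟩
    rw [hgs ⟨x, hx⟩, ← sub_smul, norm_smul, PiLp.norm_single, norm_one, mul_one]
    exact (ContinuousMap.dist_apply_le_dist (f := fi) (g := s) ⟨x, hx⟩).trans hsd.le
  choose g hg hgf using hcoord
  refine ⟨∑ i, g i, Submodule.sum_mem _ fun i _ => hg i, fun x hx => ?_⟩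
  have hsum : f x = ∑ i, f x i • EuclideanSpace.single i (1 : ℝ) := by
    ext j
    simp [Pi.single_apply]
  rw [hsum, Finset.sum_apply, ← Finset.sum_sub_distrib]
  refine (norm_sum_le_of_le _ fun i _ => hgf i x hx).trans ?_
  rw [Finset.sum_const, Finset.card_univ, Fintype.card_fin, nsmul_eq_mul, mul_div_assoc',
    div_le_iff₀ (by positivity)]
  nlinarith

theorem continuous_of_mem_shallow {τ : ℝ → ℝ} (hτ : Continuous τ) {n m : ℕ} {f : Vec n → Vec m}
    (hf : f ∈ shallow τ n m) : Continuous f := by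
  induction hf using Submodule.span_induction with
  | mem f hf => obtain ⟨a, b, c, rfl⟩ := hf; fun_prop
  | zero => exact continuous_const
  | add f g _ _ hf hg => exact hf.add hg
  | smul r f _ hf => exact hf.const_smul r

theorem bounded_of_mem_shallow {τ : ℝ → ℝ} {B : ℝ} (hB : ∀ t, |τ t| ≤ B) {n m : ℕ}
    {f : Vec n → Vec m} (hf : f ∈ shallow τ n m) : ∃ C, ∀ x, ‖f x‖ ≤ C := by
  induction hf using Submodule.span_induction with
  | mem f hf =>
    obtain ⟨a, b, c, rfl⟩ := hf
    exact ⟨B * ‖c‖, fun x => by rw [norm_smul]; gcongr; exact hB _⟩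
  | zero => exact ⟨0, fun x => by simp⟩
  | add f g _ _ hf hg =>
    obtain ⟨C, hC⟩ := hf
    obtain ⟨D, hD⟩ := hg
    exact ⟨C + D, fun x => norm_add_le_of_le (hC x) (hD x)⟩
  | smul r f _ hf =>
    obtain ⟨C, hC⟩ := hf
    exact ⟨‖r‖ * C, fun x => by
      rw [Pi.smul_apply, norm_smul]; gcongr; exact hC x⟩

/-! ### Networks -/

/-- A function in `shallow σ n m` is computed by a network. -/
theorem exists_network_of_mem_shallow {σ : ℝ → ℝ} {n m : ℕ} {f : Vec n → Vec m}
    (hf : f ∈ shallow σ n m) : ∃ N : Network n m, N.eval σ = f := by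
  have hrep : ∃ (l : ℕ) (A : Matrix (Fin l) (Fin n) ℝ) (b : Fin l → ℝ) (c : Fin l → Vec m),
      f = fun x => ∑ j, σ ((A *ᵥ x.ofLp + b) j) • c j := by
    induction hf using Submodule.span_induction with
    | mem f hf =>
      obtain ⟨a, b, c, rfl⟩ := hf
      refine ⟨1, Matrix.of fun _ => a.ofLp, fun _ => b, fun _ => c, ?_⟩
      ext1 x
      simp [Matrix.mulVec, dotProduct, PiLp.inner_apply, mul_comm]
    | zero => exact ⟨0, 0, 0, 0, by ext1 x; simp⟩
    | add f g _ _ hf hg =>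
      obtain ⟨l, A, b, c, rfl⟩ := hf
      obtain ⟨l', A', b', c', rfl⟩ := hg
      refine ⟨l + l', Matrix.of (Fin.append (fun i j => A i j) fun i j => A' i j),
        Fin.append b b', Fin.append c c', ?_⟩
      ext1 x
      simp only [Fin.sum_univ_add, Pi.add_apply, Matrix.mulVec, Matrix.of_apply, Fin.append_left,
        Fin.append_right]
    | smul r f _ hf =>
      obtain ⟨l, A, b, c, rfl⟩ := hf
      refine ⟨l, A, b, fun j => r • c j, ?_⟩
      ext1 x
      simp only [Pi.smul_apply, Finset.smul_sum]
      exact Finset.sum_congr rfl fun j _ => smul_comm _ _ _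
  obtain ⟨l, A, b, c, rfl⟩ := hrep
  refine ⟨.hidden A b (.output (Matrix.of fun i j => c j i) 0), ?_⟩
  ext x i
  simp [Network.eval, Matrix.mulVec, dotProduct, mul_comm]

/-- Networks can be composed: the output layer of the first one is merged into the next layer. -/
theorem exists_network_comp (σ : ℝ → ℝ) {n l m : ℕ} (N₁ : Network n l) (N₂ : Network l m) :
    ∃ N : Network n m, N.eval σ = N₂.eval σ ∘ N₁.eval σ := by
  induction N₁ with
  | output A b =>
    cases N₂ with
    | output A' b' =>
      refine ⟨.output (A' * A) (A' *ᵥ b + b'), ?_⟩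
      ext1 x
      simp [Network.eval, Matrix.mulVec_add, add_assoc]
    | hidden A' b' rest =>
      refine ⟨.hidden (A' * A) (A' *ᵥ b + b') rest, ?_⟩
      ext1 x
      simp [Network.eval, Matrix.mulVec_add, add_assoc]
  | hidden A b rest ih =>
    obtain ⟨N, hN⟩ := ih N₂
    refine ⟨.hidden A b N, ?_⟩
    ext1 x
    simp [Network.eval, hN]

/-! ### Bounded differences of the activation function -/

/-- Some difference `s ↦ σ (s + h) - σ s` is not constant, since otherwise `σ - σ 0` would be
additive, hence linear. -/
theorem IsActivation.exists_sub_ne {σ : ℝ → ℝ} (hσ : IsActivation σ) :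
    ∃ h s t, σ (s + h) - σ s ≠ σ (t + h) - σ t := by
  by_contra! hc
  let f : ℝ →+ ℝ := AddMonoidHom.mk' (fun t => σ t - σ 0) fun s t => by
    have := hc t s 0
    rw [zero_add] at this
    linarith
  have hf : Continuous f := hσ.continuous.sub continuous_const
  refine hσ.not_affine ⟨f 1, σ 0, fun t => ?_⟩
  have h1 : f t = t * f 1 := by simpa using map_real_smul f hf t 1
  have h2 : f t = σ t - σ 0 := rfl
  linarith

theorem shallow_sub_le (σ : ℝ → ℝ) (h : ℝ) (n m : ℕ) :
    shallow (fun s => σ (s + h) - σ s) n m ≤ shallow σ n m := by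
  refine Submodule.span_le.2 ?_
  rintro _ ⟨a, b, c, rfl⟩
  have : (fun x : Vec n => (σ (inner ℝ a x + b + h) - σ (inner ℝ a x + b)) • c)
      = (fun x => σ (inner ℝ a x + (b + h)) • c) - fun x => σ (inner ℝ a x + b) • c := by
    ext1 x
    simp [sub_smul, add_assoc]
  rw [this]
  exact Submodule.sub_mem _ (Submodule.subset_span ⟨a, b + h, c, rfl⟩)
    (Submodule.subset_span ⟨a, b, c, rfl⟩)

/-! ### Density in `L²` of bounded networks -/

/-- Bounded networks are dense in `L²(m)` for every finite measure `m`. On a compact set of almost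
full measure, a compactly supported function `f` is approximated by a network `g`. Outside of it
`g` may be large, so `g` is followed by a fixed bounded network `ρ` which is close to the identity
on a ball around the range of `f`; the bound on `ρ ∘ g` does not depend on the compact set. -/
theorem exists_network_eLpNorm_sub_le {σ : ℝ → ℝ} (hσ : IsActivation σ) {n p : ℕ}
    (m : Measure (Vec n)) [IsFiniteMeasure m] {f : Vec n → Vec p} (hf : MemLp f 2 m) {ε : ℝ≥0∞}
    (hε : ε ≠ 0) :
    ∃ N : Network n p, Continuous (N.eval σ) ∧ (∃ C, ∀ x, ‖N.eval σ x‖ ≤ C) ∧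
      eLpNorm (f - N.eval σ) 2 m ≤ ε := by
  obtain ⟨h, s, t, hst⟩ := hσ.exists_sub_ne
  set τ : ℝ → ℝ := fun s => σ (s + h) - σ s
  have hτ : Continuous τ := by have := hσ.continuous; fun_prop
  obtain ⟨C, hC⟩ := hσ.growth
  have hB : ∀ t, |τ t| ≤ C * (1 + |h|) := fun t => by simpa using hC (t + h) t
  obtain ⟨η, hη0, hηε⟩ := ENNReal.lt_iff_exists_nnreal_btwn.1 (pos_iff_ne_zero.2 hε)
  have hη : (0 : ℝ) < η := by exact_mod_cast hη0
  obtain ⟨f₀, hf₀s, hf₀, hf₀c, hf₀m⟩ := hf.exists_hasCompactSupport_eLpNorm_sub_le (by simp)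
    (ε := ENNReal.ofReal (η / 3)) (by simpa using hη)
  obtain ⟨R, hR⟩ := hf₀s.exists_bound_of_continuous hf₀c
  -- The bound `D` on `ρ` depends on `δ`, and the compact set `K` is chosen after both of them.
  obtain ⟨δ, hδ, hδ1, hδη⟩ : ∃ δ : ℝ, 0 < δ ∧ δ ≤ 1 ∧
      2 * δ * (m Set.univ).toReal ^ (1 / 2 : ℝ) ≤ η / 3 := by
    set T := (m Set.univ).toReal ^ (1 / 2 : ℝ)
    have hT : 0 ≤ T := by positivity
    refine ⟨min 1 (η / 3 / (2 * (T + 1))), by positivity, min_le_left _ _, ?_⟩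
    calc 2 * min 1 (η / 3 / (2 * (T + 1))) * T ≤ 2 * (η / 3 / (2 * (T + 1))) * (T + 1) := by
          gcongr
          · exact min_le_right _ _
          · linarith
      _ = η / 3 := by field_simp
  obtain ⟨ρ, hρ, hρid⟩ := exists_shallow_norm_sub_le (isCompact_closedBall (0 : Vec p) (R + 1)) hτ
    hB ⟨s, t, hst⟩ continuous_id hδ
  obtain ⟨D, hD⟩ := bounded_of_mem_shallow hB hρ
  have hD0 : 0 ≤ D := (norm_nonneg _).trans (hD 0)
  have hR0 : 0 ≤ R := (norm_nonneg _).trans (hR 0)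
  obtain ⟨K, -, hK, hKm⟩ := MeasurableSet.univ.exists_isCompact_sdiff_lt (μ := m)
    (measure_ne_top _ _) (ε := ENNReal.ofReal ((η / 3 / (R + D + 1)) ^ 2))
    (ENNReal.ofReal_pos.2 (by positivity)).ne'
  obtain ⟨g, hg, hgf⟩ := exists_shallow_norm_sub_le hK hτ hB ⟨s, t, hst⟩ hf₀c hδ
  obtain ⟨N₁, hN₁⟩ := exists_network_of_mem_shallow (shallow_sub_le σ h n p hg)
  obtain ⟨N₂, hN₂⟩ := exists_network_of_mem_shallow (shallow_sub_le σ h p p hρ)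
  obtain ⟨N, hN⟩ := exists_network_comp σ N₁ N₂
  rw [hN₁, hN₂] at hN
  have hNc : Continuous (N.eval σ) := by
    rw [hN]; exact (continuous_of_mem_shallow hτ hρ).comp (continuous_of_mem_shallow hτ hg)
  refine ⟨N, hNc, ⟨D, fun x => by rw [hN]; exact hD _⟩, ?_⟩
  have hpt : ∀ x, ‖(f₀ - N.eval σ) x‖ ≤
      ‖(fun _ => 2 * δ) x + (Kᶜ).indicator (fun _ => R + D) x‖ := by
    intro x
    by_cases hx : x ∈ K
    · have h1 := hgf x hx
      have h2 : g x ∈ Metric.closedBall (0 : Vec p) (R + 1) := by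
        rw [mem_closedBall_zero_iff]
        calc ‖g x‖ = ‖f₀ x - (f₀ x - g x)‖ := by congr 1; abel
          _ ≤ ‖f₀ x‖ + ‖f₀ x - g x‖ := norm_sub_le _ _
          _ ≤ R + 1 := add_le_add (hR x) (h1.trans hδ1)
      have h3 := hρid _ h2
      have h4 : (f₀ - N.eval σ) x = (f₀ x - g x) + (id (g x) - ρ (g x)) := by
        simp [hN]
      rw [h4]
      refine (norm_add_le_of_le h1 h3).trans ?_
      simp only [Set.indicator_of_notMem (show x ∉ Kᶜ by simpa using hx)]
      rw [Real.norm_of_nonneg (by linarith)]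
      linarith
    · rw [Set.indicator_of_mem hx, Real.norm_of_nonneg (by linarith), hN]
      refine (norm_sub_le _ _).trans ?_
      have := hR x
      have := hD (g x)
      simp only [Function.comp_apply]
      linarith
  have h1 : eLpNorm (f₀ - N.eval σ) 2 m ≤ ENNReal.ofReal (η / 3) + ENNReal.ofReal (η / 3) := by
    refine (eLpNorm_mono hpt).trans ((eLpNorm_add_le (by fun_prop) ?_ (by norm_num)).trans ?_)
    · exact (aestronglyMeasurable_const).indicator hK.measurableSet.compl
    gcongr
    · rw [eLpNorm_const' _ (by simp) (by simp)]
      rw [← ofReal_norm, Real.norm_of_nonneg (by positivity), ENNReal.toReal_ofNat,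
        ← ENNReal.ofReal_toReal (measure_ne_top m Set.univ),
        ENNReal.ofReal_rpow_of_nonneg (by positivity) (by positivity),
        ← ENNReal.ofReal_mul (by positivity)]
      exact ENNReal.ofReal_le_ofReal hδη
    · refine (eLpNorm_indicator_const_le _ _).trans ?_
      rw [← ofReal_norm, Real.norm_of_nonneg (by positivity), ENNReal.toReal_ofNat]
      have hKm' : m Kᶜ ≤ ENNReal.ofReal ((η / 3 / (R + D + 1)) ^ 2) := by
        rw [Set.compl_eq_univ_sdiff]; exact hKm.le
      calc ENNReal.ofReal (R + D) * m Kᶜ ^ (1 / 2 : ℝ)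
          ≤ ENNReal.ofReal (R + D + 1) *
            ENNReal.ofReal ((η / 3 / (R + D + 1)) ^ 2) ^ (1 / 2 : ℝ) := by
            refine mul_le_mul' (ENNReal.ofReal_le_ofReal (by linarith)) ?_
            gcongr
        _ = ENNReal.ofReal (η / 3) := by
            rw [ENNReal.ofReal_rpow_of_nonneg (by positivity) (by positivity),
              ← Real.sqrt_eq_rpow, Real.sqrt_sq (by positivity),
              ← ENNReal.ofReal_mul (by positivity)]
            congr 1
            field_simp
  calc eLpNorm (f - N.eval σ) 2 m = eLpNorm ((f - f₀) + (f₀ - N.eval σ)) 2 m := by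
        congr 1; abel
    _ ≤ ENNReal.ofReal (η / 3) + (ENNReal.ofReal (η / 3) + ENNReal.ofReal (η / 3)) :=
        (eLpNorm_add_le (hf.1.sub hf₀m.1) (hf₀m.1.sub hNc.aestronglyMeasurable)
          (by norm_num)).trans (add_le_add hf₀ h1)
    _ = ENNReal.ofReal η := by
        rw [← ENNReal.ofReal_add (by positivity) (by positivity),
          ← ENNReal.ofReal_add (by positivity) (by positivity)]
        congr 1; ring
    _ ≤ ε := by rw [ENNReal.ofReal_coe_nnreal]; exact hηε.le

open ProbabilityTheory

/-! ### Couplings and the Wasserstein topology -/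

instance {d : ℕ} (μ : P2 d) : IsProbabilityMeasure μ.toMeasure := μ.isProbabilityMeasure

theorem exists_coupling_of_W2_lt {d : ℕ} {μ μ' : P2 d} {r : ℝ≥0∞} (h : W2 μ μ' < r) :
    ∃ γ, IsCoupling μ μ' γ ∧ ∫⁻ z, ‖z.1 - z.2‖ₑ ^ 2 ∂γ < r ^ 2 := by
  have h1 : W2 μ μ' ^ 2 < r ^ 2 := ENNReal.pow_lt_pow_left two_ne_zero h
  rw [W2, ← ENNReal.rpow_natCast, ← ENNReal.rpow_mul] at h1
  norm_num at h1
  simpa [iInf_lt_iff] using h1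

theorem W2_lt_of_isCoupling {d : ℕ} {μ μ' : P2 d} {γ : Measure (Vec d × Vec d)}
    (hγ : IsCoupling μ μ' γ) {r : ℝ≥0∞} (h : ∫⁻ z, ‖z.1 - z.2‖ₑ ^ 2 ∂γ < r ^ 2) :
    W2 μ μ' < r := by
  have h1 : (⨅ (γ : Measure (Vec d × Vec d)) (_ : IsCoupling μ μ' γ),
      ∫⁻ z, ‖z.1 - z.2‖ₑ ^ 2 ∂γ) < r ^ 2 := (iInf₂_le γ hγ).trans_lt h
  rw [W2]
  have h2 := ENNReal.rpow_lt_rpow h1 (by norm_num : (0 : ℝ) < 1 / 2)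
  rwa [← ENNReal.rpow_natCast, ← ENNReal.rpow_mul, show ((2 : ℕ) : ℝ) * (1 / 2) = 1 by norm_num,
    ENNReal.rpow_one] at h2

/-- The mass of a closed set is upper semicontinuous in the Wasserstein topology. -/
theorem isOpen_setOf_measure_lt {d : ℕ} {F : Set (Vec d)} (hF : IsClosed F) (c : ℝ≥0∞) :
    IsOpen {μ : P2 d | μ.toMeasure F < c} := by
  intro μ hμ
  have ht := tendsto_measure_cthickening_of_isClosed (μ := μ.toMeasure) (s := F)
    ⟨1, one_pos, measure_ne_top _ _⟩ hF
  have hev : ∀ᶠ δ in 𝓝[>] (0 : ℝ), μ.toMeasure (Metric.cthickening δ F) < c :=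
    (ht.eventually_lt_const hμ).filter_mono nhdsWithin_le_nhds
  obtain ⟨δ, hδc, hδ⟩ := (hev.and self_mem_nhdsWithin).exists
  have hδ0 : (0 : ℝ) < δ := hδ
  -- The slack `e` bounds the mass that a coupling moves by more than `δ`, by Chebyshev's inequality.
  set e := c - μ.toMeasure (Metric.cthickening δ F) with he
  have he0 : 0 < e := tsub_pos_of_lt hδc
  have hsq : (ENNReal.ofReal δ * e ^ (1 / 2 : ℝ)) ^ 2 = ENNReal.ofReal δ ^ 2 * e := by
    rw [mul_pow, ← ENNReal.rpow_natCast (e ^ (1 / 2 : ℝ)), ← ENNReal.rpow_mul]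
    norm_num
  refine ⟨ENNReal.ofReal δ * e ^ (1 / 2 : ℝ),
    ENNReal.mul_pos (by simpa using hδ0) (by simp [he0.ne']), fun μ' h => ?_⟩
  obtain ⟨γ, ⟨hγ₁, hγ₂⟩, hγ⟩ := exists_coupling_of_W2_lt h
  rw [hsq] at hγ
  have hcheb := mul_meas_ge_le_lintegral₀ (μ := γ) (f := fun z => ‖z.1 - z.2‖ₑ ^ 2)
    (by fun_prop) (ENNReal.ofReal δ ^ 2)
  have hfar := lt_of_mul_lt_mul_left' (hcheb.trans_lt hγ)
  have hsub : Prod.snd ⁻¹' F ⊆ Prod.fst ⁻¹' Metric.cthickening δ F ∪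
      {z : Vec d × Vec d | ENNReal.ofReal δ ^ 2 ≤ ‖z.1 - z.2‖ₑ ^ 2} := by
    intro z hz
    by_cases hd : dist z.1 z.2 ≤ δ
    · exact Or.inl (Metric.mem_cthickening_of_dist_le _ _ _ _ hz hd)
    · right
      rw [dist_eq_norm, not_le] at hd
      simp only [Set.mem_ofPred_eq, ← ofReal_norm]
      gcongr
  calc μ'.toMeasure F = γ (Prod.snd ⁻¹' F) := by
        rw [← hγ₂, Measure.map_apply measurable_snd hF.measurableSet]
    _ ≤ γ (Prod.fst ⁻¹' Metric.cthickening δ F) +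
        γ {z | ENNReal.ofReal δ ^ 2 ≤ ‖z.1 - z.2‖ₑ ^ 2} :=
        (measure_mono hsub).trans (measure_union_le _ _)
    _ = μ.toMeasure (Metric.cthickening δ F) +
        γ {z | ENNReal.ofReal δ ^ 2 ≤ ‖z.1 - z.2‖ₑ ^ 2} := by
        rw [← hγ₁, Measure.map_apply measurable_fst Metric.isClosed_cthickening.measurableSet]
    _ < μ.toMeasure (Metric.cthickening δ F) + e :=
        ENNReal.add_lt_add_left (measure_ne_top _ _) hfar
    _ = c := add_tsub_cancel_of_le hδc.le

theorem measurable_toMeasure (d : ℕ) : Measurable (P2.toMeasure : P2 d → Measure (Vec d)) := by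
  refine Measurable.measure_of_isPiSystem_of_isProbabilityMeasure
    (S := {s : Set (Vec d) | IsClosed s}) ?_ isPiSystem_isClosed fun F hF =>
      measurable_of_Iio fun c => (isOpen_setOf_measure_lt hF c).measurableSet
  rw [← borel_eq_generateFrom_isClosed]
  exact BorelSpace.measurable_eq

/-- If a mass `q i ≤ P (c i)` is removed from each of finitely many disjoint cells `c i`, in
proportion to `P`, then the second moment of the remaining measure `α` is controlled by the masses
left in the cells and by the second moment of `P` outside of the cells. -/
theorem exists_remainder {d : ℕ} (P : Measure (Vec d)) [IsProbabilityMeasure P] (s : Finset ℕ)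
    (c : ℕ → Set (Vec d)) (hc : ∀ i, MeasurableSet (c i)) (hd : Pairwise (Function.onFun Disjoint c))
    (q R : ℕ → ℝ≥0∞) (hq : ∀ i, q i ≤ P (c i)) (hR : ∀ i, ∀ x ∈ c i, ‖x‖ₑ ^ 2 ≤ R i) :
    ∃ α : Measure (Vec d), ∑ i ∈ s, q i • cond P (c i) + α = P ∧
      ∫⁻ x, ‖x‖ₑ ^ 2 ∂α ≤ ∑ i ∈ s, (P (c i) - q i) * R i +
        ∫⁻ x in (⋃ i ∈ s, c i)ᶜ, ‖x‖ₑ ^ 2 ∂P := by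
  refine ⟨∑ i ∈ s, (P (c i) - q i) • cond P (c i) + P.restrict (⋃ i ∈ s, c i)ᶜ, ?_, ?_⟩
  · rw [← add_assoc, ← Finset.sum_add_distrib]
    have h1 : ∀ i, q i • cond P (c i) + (P (c i) - q i) • cond P (c i) = P.restrict (c i) := by
      intro i
      rw [← add_smul, add_tsub_cancel_of_le (hq i), ProbabilityTheory.cond, smul_smul]
      by_cases h0 : P (c i) = 0
      · rw [Measure.restrict_eq_zero.2 h0, smul_zero]
      · rw [ENNReal.mul_inv_cancel h0 (measure_ne_top _ _), one_smul]
    simp only [h1]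
    have h2 : ∑ i ∈ s, P.restrict (c i) = P.restrict (⋃ i ∈ s, c i) := by
      ext t ht
      rw [Measure.finsetSum_apply, Measure.restrict_apply ht, Set.inter_iUnion₂,
        measure_biUnion_finset (fun i _ j _ hij => (hd hij).mono Set.inter_subset_right
          Set.inter_subset_right) (fun i _ => ht.inter (hc i))]
      exact Finset.sum_congr rfl fun i _ => Measure.restrict_apply ht
    rw [h2, Measure.restrict_add_restrict_compl (s.measurableSet_biUnion fun i _ => hc i)]
  · rw [lintegral_add_measure, lintegral_finsetSum_measure]
    gcongr with i hi
    rw [lintegral_smul_measure, smul_eq_mul]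
    gcongr
    calc ∫⁻ x, ‖x‖ₑ ^ 2 ∂(cond P (c i)) ≤ ∫⁻ _, R i ∂(cond P (c i)) :=
          lintegral_mono_ae (ae_cond_of_forall_mem (hc i) (hR i))
      _ ≤ R i := by
          rw [lintegral_const]
          exact mul_le_of_le_one_right' prob_le_one

theorem enorm_sub_sq_le {E : Type*} [NormedAddCommGroup E] (x y : E) :
    ‖x - y‖ₑ ^ 2 ≤ 2 * ‖x‖ₑ ^ 2 + 2 * ‖y‖ₑ ^ 2 := by
  have h : ‖x - y‖ ^ 2 ≤ 2 * ‖x‖ ^ 2 + 2 * ‖y‖ ^ 2 := by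
    nlinarith [norm_sub_le x y, norm_nonneg (x - y), sq_nonneg (‖x‖ - ‖y‖)]
  have h2 := ENNReal.ofReal_le_ofReal h
  rw [ENNReal.ofReal_add (by positivity) (by positivity), ENNReal.ofReal_mul (by positivity),
    ENNReal.ofReal_mul (by positivity), ENNReal.ofReal_pow (by positivity),
    ENNReal.ofReal_pow (by positivity), ENNReal.ofReal_pow (by positivity)] at h2
  simpa using h2

theorem map_sum_measure {α β ι : Type*} [MeasurableSpace α] [MeasurableSpace β] {f : α → β}
    (hf : Measurable f) (s : Finset ι) (μ : ι → Measure α) :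
    (∑ i ∈ s, μ i).map f = ∑ i ∈ s, (μ i).map f := by
  simp only [← Measure.mapₗ_apply_of_measurable hf, map_sum]

/-- The mass `min (μ (c i)) (μ' (c i))` that two measures share in the cell `c i` is coupled within
the cell, at a cost of at most the squared diameter `δ`, and the remaining masses are coupled
independently. -/
theorem exists_coupling_le {d : ℕ} (μ μ' : P2 d) (s : Finset ℕ) (c : ℕ → Set (Vec d))
    (hc : ∀ i, MeasurableSet (c i)) (hd : Pairwise (Function.onFun Disjoint c)) (δ : ℝ≥0∞)
    (hδ : ∀ i, ∀ x ∈ c i, ∀ y ∈ c i, ‖x - y‖ₑ ^ 2 ≤ δ) (R : ℕ → ℝ≥0∞)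
    (hR : ∀ i, ∀ x ∈ c i, ‖x‖ₑ ^ 2 ≤ R i) :
    ∃ γ, IsCoupling μ μ' γ ∧ ∫⁻ z, ‖z.1 - z.2‖ₑ ^ 2 ∂γ ≤ δ +
      (2 * (∑ i ∈ s, (μ.toMeasure (c i) - μ'.toMeasure (c i)) * R i +
        ∫⁻ x in (⋃ i ∈ s, c i)ᶜ, ‖x‖ₑ ^ 2 ∂μ.toMeasure) +
      2 * (∑ i ∈ s, (μ'.toMeasure (c i) - μ.toMeasure (c i)) * R i +
        ∫⁻ x in (⋃ i ∈ s, c i)ᶜ, ‖x‖ₑ ^ 2 ∂μ'.toMeasure)) := by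
  set P := μ.toMeasure
  set P' := μ'.toMeasure
  set q : ℕ → ℝ≥0∞ := fun i => min (P (c i)) (P' (c i)) with hqdef
  obtain ⟨α, hα, hαR⟩ := exists_remainder P s c hc hd q R (fun i => min_le_left _ _) hR
  obtain ⟨α', hα', hαR'⟩ := exists_remainder P' s c hc hd q R (fun i => min_le_right _ _) hR
  have hcond : ∀ i, q i ≠ 0 → cond P (c i) Set.univ = 1 ∧ cond P' (c i) Set.univ = 1 := by
    intro i hi
    have h1 : P (c i) ≠ 0 := fun h => hi (by simp [hqdef, h])
    have h2 : P' (c i) ≠ 0 := fun h => hi (by simp [hqdef, h])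
    exact ⟨(cond_isProbabilityMeasure h1).measure_univ, (cond_isProbabilityMeasure h2).measure_univ⟩
  have hmass : ∑ i ∈ s, q i + α Set.univ = 1 := by
    rw [← measure_univ (μ := P), ← hα, Measure.add_apply, Measure.finsetSum_apply]
    congr 1
    refine Finset.sum_congr rfl fun i _ => ?_
    by_cases h : q i = 0
    · simp [h]
    · simp [(hcond i h).1]
  have hmass' : ∑ i ∈ s, q i + α' Set.univ = 1 := by
    rw [← measure_univ (μ := P'), ← hα', Measure.add_apply, Measure.finsetSum_apply]
    congr 1
    refine Finset.sum_congr rfl fun i _ => ?_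
    by_cases h : q i = 0
    · simp [h]
    · simp [(hcond i h).2]
  have hsum : ∑ i ∈ s, q i ≤ 1 := hmass ▸ le_self_add
  -- The remainders have the same mass `θ`, so that `θ⁻¹ • α.prod α'` has marginals `α` and `α'`.
  -- If `θ = 0`, then `θ⁻¹ = ∞`, but `α` and `α'` vanish.
  have hθ : α Set.univ = α' Set.univ :=
    (ENNReal.add_right_inj (hsum.trans_lt ENNReal.one_lt_top).ne).1 (hmass.trans hmass'.symm)
  have hθ1 : α Set.univ ≤ 1 := hmass ▸ le_add_self
  have : IsFiniteMeasure α := ⟨hθ1.trans_lt ENNReal.one_lt_top⟩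
  have : IsFiniteMeasure α' := ⟨hθ ▸ hθ1.trans_lt ENNReal.one_lt_top⟩
  have hnorm : ∀ β : Measure (Vec d), β Set.univ = α Set.univ →
      ((α Set.univ)⁻¹ * α Set.univ) • β = β := by
    intro β hβ
    by_cases h0 : α Set.univ = 0
    · rw [h0, Measure.measure_univ_eq_zero] at hβ
      simp [hβ]
    · rw [ENNReal.inv_mul_cancel h0 (measure_ne_top _ _), one_smul]
  refine ⟨∑ i ∈ s, q i • (cond P (c i)).prod (cond P' (c i)) +
    (α Set.univ)⁻¹ • α.prod α', ⟨?_, ?_⟩, ?_⟩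
  · rw [Measure.map_add _ _ measurable_fst, map_sum_measure measurable_fst, Measure.map_smul,
      Measure.map_fst_prod, smul_smul, ← hθ, hnorm α rfl]
    refine Eq.trans ?_ hα
    congr 1
    refine Finset.sum_congr rfl fun i _ => ?_
    rw [Measure.map_smul, Measure.map_fst_prod]
    by_cases h : q i = 0
    · simp [h]
    · rw [(hcond i h).2, one_smul]
  · rw [Measure.map_add _ _ measurable_snd, map_sum_measure measurable_snd, Measure.map_smul,
      Measure.map_snd_prod, smul_smul, hnorm α' hθ.symm]
    refine Eq.trans ?_ hα'
    congr 1
    refine Finset.sum_congr rfl fun i _ => ?_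
    rw [Measure.map_smul, Measure.map_snd_prod]
    by_cases h : q i = 0
    · simp [h]
    · rw [(hcond i h).1, one_smul]
  · rw [lintegral_add_measure, lintegral_finsetSum_measure, lintegral_smul_measure, smul_eq_mul]
    refine add_le_add ?_ ?_
    · have h1 : ∀ i ∈ s, ∫⁻ z, ‖z.1 - z.2‖ₑ ^ 2 ∂(q i • (cond P (c i)).prod (cond P' (c i)))
          ≤ q i * δ := by
        intro i _
        rw [lintegral_smul_measure, smul_eq_mul]
        gcongr
        have hae : ∀ᵐ z ∂(cond P (c i)).prod (cond P' (c i)), ‖z.1 - z.2‖ₑ ^ 2 ≤ δ := by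
          filter_upwards [Measure.quasiMeasurePreserving_fst.ae (ae_cond_mem (hc i)),
            Measure.quasiMeasurePreserving_snd.ae (ae_cond_mem (hc i))] with z h1 h2
          exact hδ i _ h1 _ h2
        refine (lintegral_mono_ae hae).trans ?_
        rw [lintegral_const]
        refine mul_le_of_le_one_right' ?_
        rw [← Set.univ_prod_univ, Measure.prod_prod]
        exact mul_le_one' prob_le_one prob_le_one
      refine (Finset.sum_le_sum h1).trans ?_
      rw [← Finset.sum_mul]
      exact mul_le_of_le_one_left' hsum
    · have hfst : ∫⁻ z, ‖z.1‖ₑ ^ 2 ∂α.prod α' = α Set.univ * ∫⁻ x, ‖x‖ₑ ^ 2 ∂α := by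
        rw [← lintegral_map (f := fun x : Vec d => ‖x‖ₑ ^ 2) (by fun_prop) measurable_fst,
          Measure.map_fst_prod, lintegral_smul_measure, smul_eq_mul, hθ]
      have hsnd : ∫⁻ z, ‖z.2‖ₑ ^ 2 ∂α.prod α' = α Set.univ * ∫⁻ x, ‖x‖ₑ ^ 2 ∂α' := by
        rw [← lintegral_map (f := fun x : Vec d => ‖x‖ₑ ^ 2) (by fun_prop) measurable_snd,
          Measure.map_snd_prod, lintegral_smul_measure, smul_eq_mul]
      have hqP : ∀ i, P (c i) - q i = P (c i) - P' (c i) := fun i => by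
        rw [hqdef]; exact tsub_min
      have hqP' : ∀ i, P' (c i) - q i = P' (c i) - P (c i) := fun i => by
        simp only [hqdef, min_comm (P (c i))]; exact tsub_min
      simp only [hqP] at hαR
      simp only [hqP'] at hαR'
      calc (α Set.univ)⁻¹ * ∫⁻ z, ‖z.1 - z.2‖ₑ ^ 2 ∂α.prod α'
          ≤ (α Set.univ)⁻¹ * ∫⁻ z, (2 * ‖z.1‖ₑ ^ 2 + 2 * ‖z.2‖ₑ ^ 2) ∂α.prod α' := by
            gcongr with z
            exact enorm_sub_sq_le _ _
        _ = ((α Set.univ)⁻¹ * α Set.univ) *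
            (2 * ∫⁻ x, ‖x‖ₑ ^ 2 ∂α + 2 * ∫⁻ x, ‖x‖ₑ ^ 2 ∂α') := by
            rw [lintegral_add_left (by fun_prop), lintegral_const_mul _ (by fun_prop),
              lintegral_const_mul _ (by fun_prop), hfst, hsnd]
            ring
        _ ≤ 2 * ∫⁻ x, ‖x‖ₑ ^ 2 ∂α + 2 * ∫⁻ x, ‖x‖ₑ ^ 2 ∂α' :=
            mul_le_of_le_one_left' (ENNReal.inv_mul_le_one _)
        _ ≤ _ := by gcongr

/-- A partition of `ℝᵈ` into countably many Borel sets, each contained in a ball of radius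
`1 / (n + 1)`. -/
noncomputable def cell (d n : ℕ) : ℕ → Set (Vec d) :=
  disjointed fun i => Metric.ball (TopologicalSpace.denseSeq (Vec d) i) (1 / (n + 1))

theorem measurableSet_cell (d n i : ℕ) : MeasurableSet (cell d n i) :=
  MeasurableSet.disjointed (fun _ => Metric.isOpen_ball.measurableSet) i

theorem cell_subset (d n i : ℕ) :
    cell d n i ⊆ Metric.ball (TopologicalSpace.denseSeq (Vec d) i) (1 / (n + 1)) :=
  disjointed_subset _ i

theorem iUnion_cell (d n : ℕ) : ⋃ i, cell d n i = Set.univ := by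
  rw [cell, iUnion_disjointed, Set.eq_univ_iff_forall]
  intro x
  obtain ⟨i, hi⟩ := (TopologicalSpace.denseRange_denseSeq (Vec d)).exists_dist_lt x
    (ε := 1 / ((n : ℝ) + 1)) (by positivity)
  exact Set.mem_iUnion.2 ⟨i, hi⟩

/-- The part of `ℝᵈ` not covered by the first `K` cells. -/
def tail (d n K : ℕ) : Set (Vec d) := (⋃ i ∈ Finset.range K, cell d n i)ᶜ

theorem measurableSet_tail (d n K : ℕ) : MeasurableSet (tail d n K) :=
  (Finset.measurableSet_biUnion _ fun i _ => measurableSet_cell d n i).compl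

theorem tendsto_tail {d : ℕ} (μ : P2 d) (n : ℕ) :
    Tendsto (fun K => ∫⁻ x in tail d n K, ‖x‖ₑ ^ 2 ∂μ.toMeasure) atTop (𝓝 0) := by
  refine tendsto_setLIntegral_zero μ.secondMoment_lt_top.ne ?_
  have h := tendsto_measure_iInter_atTop (μ := μ.toMeasure) (s := tail d n)
    (fun K => (measurableSet_tail d n K).nullMeasurableSet)
    (fun K K' h => Set.compl_subset_compl.2
      (Set.biUnion_subset_biUnion_left (by simpa using h)))
    ⟨0, measure_ne_top _ _⟩
  have h0 : ⋂ K, tail d n K = ∅ := by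
    rw [Set.eq_empty_iff_forall_notMem]
    intro x hx
    obtain ⟨i, hi⟩ := Set.mem_iUnion.1 ((iUnion_cell d n).symm ▸ Set.mem_univ x)
    have h1 := Set.mem_iInter.1 hx (i + 1)
    exact h1 (Set.mem_biUnion (by simp : i ∈ (Finset.range (i + 1) : Set ℕ)) hi)
  rwa [h0, measure_empty] at h

/-- The masses of the cells and the second moments of the tails, for all of the cell sizes. -/
noncomputable def stats (d : ℕ) (μ : P2 d) : (ℕ × ℕ → ℝ≥0∞) × (ℕ × ℕ → ℝ≥0∞) :=
  (fun a => μ.toMeasure (cell d a.1 a.2), fun a => ∫⁻ x in tail d a.1 a.2, ‖x‖ₑ ^ 2 ∂μ.toMeasure)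

/-- Measures with nearby statistics are close in the Wasserstein distance. -/
theorem eventually_W2_lt {d : ℕ} (μ : P2 d) {r : ℝ≥0∞} (hr : 0 < r) :
    ∀ᶠ y in 𝓝 (stats d μ), ∀ μ', stats d μ' = y → W2 μ μ' < r := by
  set η : ℝ≥0∞ := min 1 (r ^ 2) / 10 with hη
  have hm0 : min 1 (r ^ 2) ≠ 0 := (lt_min one_pos (ENNReal.pow_pos hr 2)).ne'
  have hmt : min 1 (r ^ 2) ≠ ∞ := ((min_le_left _ _).trans_lt ENNReal.one_lt_top).ne
  have hη0 : 0 < η := ENNReal.div_pos hm0 (by simp)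
  have hηt : η ≠ ∞ := ENNReal.div_ne_top hmt (by simp)
  have h10 : 10 * η ≤ r ^ 2 := by
    rw [hη, ENNReal.mul_div_cancel (by simp) (by simp)]
    exact min_le_right _ _
  obtain ⟨n, hn⟩ : ∃ n : ℕ, ENNReal.ofReal (2 * (1 / ((n : ℝ) + 1))) ^ 2 < η := by
    have h1 : Tendsto (fun n : ℕ => ENNReal.ofReal (2 * (1 / ((n : ℝ) + 1))) ^ 2) atTop (𝓝 0) := by
      have h2 := (tendsto_one_div_add_atTop_nhds_zero_nat (𝕜 := ℝ)).const_mul 2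
      have h3 := ENNReal.Tendsto.pow (n := 2) (ENNReal.tendsto_ofReal h2)
      simpa using h3
    exact (h1.eventually_lt_const hη0).exists
  obtain ⟨K, hK⟩ := ((tendsto_tail μ n).eventually_lt_const hη0).exists
  set R : ℕ → ℝ≥0∞ := fun i =>
    ENNReal.ofReal (‖TopologicalSpace.denseSeq (Vec d) i‖ + 1 / ((n : ℝ) + 1)) ^ 2 with hRdef
  have hR : ∀ i, ∀ x ∈ cell d n i, ‖x‖ₑ ^ 2 ≤ R i := by
    intro i x hx
    have h1 := cell_subset d n i hx
    rw [mem_ball_iff_norm] at h1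
    rw [← ofReal_norm]
    change _ ≤ ENNReal.ofReal _ ^ 2
    gcongr
    have := norm_le_norm_add_norm_sub' x (TopologicalSpace.denseSeq (Vec d) i)
    linarith
  have hδ : ∀ i, ∀ x ∈ cell d n i, ∀ y ∈ cell d n i,
      ‖x - y‖ₑ ^ 2 ≤ ENNReal.ofReal (2 * (1 / ((n : ℝ) + 1))) ^ 2 := by
    intro i x hx y hy
    have h1 := Metric.mem_ball.1 (cell_subset d n i hx)
    have h2 := Metric.mem_ball.1 (cell_subset d n i hy)
    rw [← ofReal_norm, ← dist_eq_norm]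
    gcongr
    have := dist_triangle_right x y (TopologicalSpace.denseSeq (Vec d) i)
    linarith
  have hRt : ∀ i, R i ≠ ∞ := fun i => by simp [hRdef]
  have hmi : ∀ i, μ.toMeasure (cell d n i) ≠ ∞ := fun i => measure_ne_top _ _
  have hcont : ∀ i, Tendsto (fun y : (ℕ × ℕ → ℝ≥0∞) × (ℕ × ℕ → ℝ≥0∞) => y.1 (n, i))
      (𝓝 (stats d μ)) (𝓝 (μ.toMeasure (cell d n i))) := fun i =>
    (Continuous.tendsto (by fun_prop : Continuous
      fun y : (ℕ × ℕ → ℝ≥0∞) × (ℕ × ℕ → ℝ≥0∞) => y.1 (n, i)) (stats d μ))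
  have e₁ : ∀ᶠ y in 𝓝 (stats d μ),
      ∑ i ∈ Finset.range K, (μ.toMeasure (cell d n i) - y.1 (n, i)) * R i < η := by
    refine Tendsto.eventually_lt_const hη0 ?_
    rw [show (0 : ℝ≥0∞) = ∑ i ∈ Finset.range K,
      (μ.toMeasure (cell d n i) - μ.toMeasure (cell d n i)) * R i by simp]
    exact tendsto_finsetSum _ fun i _ => ENNReal.Tendsto.mul_const
      (ENNReal.Tendsto.sub tendsto_const_nhds (hcont i) (Or.inl (hmi i))) (Or.inr (hRt i))
  have e₂ : ∀ᶠ y in 𝓝 (stats d μ),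
      ∑ i ∈ Finset.range K, (y.1 (n, i) - μ.toMeasure (cell d n i)) * R i < η := by
    refine Tendsto.eventually_lt_const hη0 ?_
    rw [show (0 : ℝ≥0∞) = ∑ i ∈ Finset.range K,
      (μ.toMeasure (cell d n i) - μ.toMeasure (cell d n i)) * R i by simp]
    exact tendsto_finsetSum _ fun i _ => ENNReal.Tendsto.mul_const
      (ENNReal.Tendsto.sub (hcont i) tendsto_const_nhds (Or.inl (hmi i))) (Or.inr (hRt i))
  have e₃ : ∀ᶠ y in 𝓝 (stats d μ), y.2 (n, K) < η :=
    (Continuous.tendsto (by fun_prop : Continuous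
      fun y : (ℕ × ℕ → ℝ≥0∞) × (ℕ × ℕ → ℝ≥0∞) => y.2 (n, K)) (stats d μ)).eventually_lt_const hK
  filter_upwards [e₁, e₂, e₃] with y h₁ h₂ h₃ μ' hμ'
  subst hμ'
  obtain ⟨γ, hγ, hγc⟩ := exists_coupling_le μ μ' (Finset.range K) (cell d n)
    (measurableSet_cell d n) (disjoint_disjointed _) _ hδ R hR
  refine W2_lt_of_isCoupling hγ (lt_of_le_of_lt hγc ?_)
  calc _ ≤ η + (2 * (η + η) + 2 * (η + η)) := by
        refine add_le_add hn.le (add_le_add ?_ ?_)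
        · exact mul_le_mul_right (add_le_add h₁.le hK.le) 2
        · exact mul_le_mul_right (add_le_add h₂.le h₃.le) 2
    _ = 9 * η := by ring
    _ < 10 * η := ENNReal.mul_lt_mul_left hη0.ne' hηt (by norm_num)
    _ ≤ r ^ 2 := h10

/-- The Borel σ-algebra of the Wasserstein distance is generated by the maps `μ ↦ μ A`: an open set
is the preimage of an open set under the countably many measurable statistics `stats d`. -/
theorem measurableSpace_le_comap (d : ℕ) :
    (inferInstance : MeasurableSpace (P2 d)) ≤
      MeasurableSpace.comap P2.toMeasure Measure.instMeasurableSpace := by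
  have hstats : @Measurable _ _ (MeasurableSpace.comap P2.toMeasure Measure.instMeasurableSpace) _
      (stats d) := by
    let S : Measure (Vec d) → (ℕ × ℕ → ℝ≥0∞) × (ℕ × ℕ → ℝ≥0∞) := fun m =>
      (fun a => m (cell d a.1 a.2), fun a => ∫⁻ x in tail d a.1 a.2, ‖x‖ₑ ^ 2 ∂m)
    have hS : Measurable S := by
      refine Measurable.prodMk (measurable_pi_lambda _ fun a =>
        Measure.measurable_coe (measurableSet_cell d a.1 a.2)) (measurable_pi_lambda _ fun a => ?_)
      simp only [← lintegral_indicator (measurableSet_tail d a.1 a.2)]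
      exact Measure.measurable_lintegral
        (Measurable.indicator (by fun_prop) (measurableSet_tail d a.1 a.2))
    exact hS.comp (comap_measurable _)
  refine MeasurableSpace.generateFrom_le fun U hU => ?_
  have hUeq : U = stats d ⁻¹' interior {y | ∀ μ', stats d μ' = y → μ' ∈ U} := by
    ext μ
    constructor
    · intro hμ
      obtain ⟨r, hr, h⟩ := hU μ hμ
      refine mem_interior_iff_mem_nhds.2 ?_
      filter_upwards [eventually_W2_lt μ hr] with y hy μ' hμ'
      exact h μ' (hy μ' hμ')
    · intro hμ
      exact interior_subset hμ μ rfl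
  rw [hUeq]
  exact hstats isOpen_interior.measurableSet

/-! ### Cylinder functions -/

/-- The Markov kernel `μ ↦ μ` from `P2 d` to `ℝᵈ`. -/
noncomputable def ker (d : ℕ) : Kernel (P2 d) (Vec d) := ⟨P2.toMeasure, measurable_toMeasure d⟩

@[simp] theorem ker_apply {d : ℕ} (μ : P2 d) : ker d μ = μ.toMeasure := rfl

instance (d : ℕ) : IsMarkovKernel (ker d) := ⟨fun μ => μ.isProbabilityMeasure⟩

/-- The map `(μ, x) ↦ (x, (μ (A i))ᵢ)`. -/
def masses {d : ℕ} {ι : Type} (A : ι → Set (Vec d)) (z : P2 d × Vec d) : Vec d × (ι → ℝ) :=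
  (z.2, fun i => z.1.toMeasure.real (A i))

theorem measurable_masses {d : ℕ} {ι : Type} {A : ι → Set (Vec d)}
    (hA : ∀ i, MeasurableSet (A i)) : Measurable (masses A) := by
  refine measurable_snd.prodMk (measurable_pi_lambda _ fun i => ?_)
  exact (((Measure.measurable_coe (hA i)).comp (measurable_toMeasure d)).comp
    measurable_fst).ennreal_toReal

/-- A cylinder function is a measurable function of `x` and of the masses `μ (A i)` of finitely many
Borel sets. -/
def IsCylinder {d : ℕ} {E : Type*} [MeasurableSpace E] (g : P2 d × Vec d → E) : Prop :=
  ∃ (ι : Type) (_ : Fintype ι) (A : ι → Set (Vec d)), (∀ i, MeasurableSet (A i)) ∧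
    ∃ G : Vec d × (ι → ℝ) → E, Measurable G ∧ g = G ∘ masses A

theorem IsCylinder.measurable {d : ℕ} {E : Type*} [MeasurableSpace E] {g : P2 d × Vec d → E}
    (hg : IsCylinder g) : Measurable g := by
  obtain ⟨ι, _, A, hA, G, hG, rfl⟩ := hg
  exact hG.comp (measurable_masses hA)

theorem IsCylinder.comp {d : ℕ} {E F : Type*} [MeasurableSpace E] [MeasurableSpace F]
    {g : P2 d × Vec d → E} (hg : IsCylinder g) {T : E → F} (hT : Measurable T) :
    IsCylinder (fun z => T (g z)) := by
  obtain ⟨ι, hι, A, hA, G, hG, rfl⟩ := hg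
  exact ⟨ι, hι, A, hA, T ∘ G, hT.comp hG, rfl⟩

theorem IsCylinder.prodMk {d : ℕ} {E F : Type*} [MeasurableSpace E] [MeasurableSpace F]
    {g : P2 d × Vec d → E} {h : P2 d × Vec d → F} (hg : IsCylinder g) (hh : IsCylinder h) :
    IsCylinder (fun z => (g z, h z)) := by
  obtain ⟨ι, hι, A, hA, G, hG, rfl⟩ := hg
  obtain ⟨κ, hκ, B, hB, H, hH, rfl⟩ := hh
  refine ⟨ι ⊕ κ, inferInstance, Sum.elim A B, ?_,
    fun y => (G (y.1, fun i => y.2 (Sum.inl i)), H (y.1, fun j => y.2 (Sum.inr j))), ?_, rfl⟩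
  · rintro (i | j)
    exacts [hA i, hB j]
  · refine Measurable.prodMk (hG.comp ?_) (hH.comp ?_) <;> fun_prop

/-- The cylinder sets form an algebra. -/
theorem isSetAlgebra_cylinder (d : ℕ) :
    IsSetAlgebra {S : Set (P2 d × Vec d) | IsCylinder (fun z => z ∈ S)} where
  empty_mem := ⟨Empty, inferInstance, fun _ => ∅, fun _ => MeasurableSet.empty, fun _ => False,
    measurable_const, rfl⟩
  compl_mem _ hs := IsCylinder.comp (T := Not) hs (measurable_of_countable _)
  union_mem _ _ hs ht := IsCylinder.comp (T := fun q : Prop × Prop => q.1 ∨ q.2) (hs.prodMk ht)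
    (measurable_of_countable _)

theorem IsCylinder.measurableSet {d : ℕ} {S : Set (P2 d × Vec d)}
    (hS : IsCylinder (fun z => z ∈ S)) : MeasurableSet S :=
  measurableSet_setOfPred.2 hS.measurable

/-- The cylinder sets generate the product σ-algebra, because the evaluations `μ ↦ μ A` generate the
Borel σ-algebra of the Wasserstein distance. -/
theorem generateFrom_cylinder (d : ℕ) : (inferInstance : MeasurableSpace (P2 d × Vec d)) =
    MeasurableSpace.generateFrom {S | IsCylinder (fun z => z ∈ S)} := by
  refine le_antisymm ?_ (MeasurableSpace.generateFrom_le fun S hS => IsCylinder.measurableSet hS)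
  refine sup_le ?_ ?_
  · refine (MeasurableSpace.comap_mono (measurableSpace_le_comap d)).trans ?_
    rw [MeasurableSpace.comap_comp, ← measurable_iff_comap_le]
    refine @Measure.measurable_of_measurable_coe _ _ _ (MeasurableSpace.generateFrom _) _
      fun s hs t ht => MeasurableSpace.measurableSet_generateFrom ?_
    refine ⟨Unit, inferInstance, fun _ => s, fun _ => hs, fun y => ENNReal.ofReal (y.2 ()) ∈ t,
      ?_, ?_⟩
    · exact measurableSet_setOfPred.1 ((by fun_prop : Measurable fun y : Vec d × (Unit → ℝ) =>
        ENNReal.ofReal (y.2 ())) ht)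
    · ext z
      simp [masses]
  · rw [← measurable_iff_comap_le]
    refine fun t ht => MeasurableSpace.measurableSet_generateFrom ?_
    exact ⟨Empty, inferInstance, fun _ => ∅, fun _ => MeasurableSet.empty, fun y => y.1 ∈ t,
      measurableSet_setOfPred.1 (measurable_fst ht), rfl⟩

/-- Cylinder functions are dense in `L²`. -/
theorem exists_isCylinder_eLpNorm_sub_le {d p : ℕ} (M : Measure (P2 d × Vec d)) [IsFiniteMeasure M]
    {f : P2 d × Vec d → Vec p} (hf : MemLp f 2 M) {ε : ℝ≥0∞} (hε : ε ≠ 0) :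
    ∃ g, eLpNorm (f - g) 2 M ≤ ε ∧ IsCylinder g := by
  have hdense := Measure.MeasureDense.of_generateFrom_isSetAlgebra_finite M
    (isSetAlgebra_cylinder d) (generateFrom_cylinder d)
  refine MemLp.induction_dense (by simp) IsCylinder ?_ ?_ ?_ hf hε
  · intro c s hs _ ε hε
    obtain ⟨η, hη, h⟩ := exists_eLpNorm_indicator_le (μ := M) (p := 2) (by simp) c hε
    obtain ⟨t, ht, hst⟩ := hdense.approx s hs (measure_ne_top _ _) η (by exact_mod_cast hη)
    refine ⟨t.indicator fun _ => c, ?_, ?_⟩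
    · rw [eLpNorm_indicator_sub_indicator]
      refine h _ ?_
      rw [symmDiff_comm]
      simpa using hst.le
    · classical
      have : (t.indicator fun _ => c) = fun z => (fun q : Prop => if q then c else 0) (z ∈ t) := by
        ext1 z
        simp [Set.indicator_apply]
      rw [this]
      exact IsCylinder.comp (T := fun q : Prop => if q then c else 0) ht
        (measurable_of_countable _)
  · intro f g hf hg
    exact (hf.prodMk hg).comp (T := fun q : Vec p × Vec p => q.1 + q.2) measurable_add
  · intro f hf
    exact hf.measurable.aestronglyMeasurable

/-! ### Replacing the masses by brackets of networks -/

theorem lintegral_enorm_sq {α E : Type*} [MeasurableSpace α] [NormedAddCommGroup E] (m : Measure α)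
    (f : α → E) : ∫⁻ z, ‖f z‖ₑ ^ 2 ∂m = eLpNorm f 2 m ^ 2 := by
  have h := eLpNorm_nnreal_pow_eq_lintegral (μ := m) (f := f) (p := 2) two_ne_zero
  simpa using h.symm

theorem measurable_bracket {d k : ℕ} {φ : Vec d → Vec k} (hφ : Measurable φ) :
    Measurable fun μ : P2 d => bracket φ μ :=
  (hφ.stronglyMeasurable.integral_kernel (κ := ker d)).measurable

/-- By Jensen's inequality, `h ↦ ∫ h dμ` is a contraction from `L²` of the mixture `∫ μ ν(dμ)` to
`L²(ν)`. -/
theorem eLpNorm_bracket_le {d k : ℕ} (ν : Measure (P2 d)) [IsProbabilityMeasure ν]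
    {h : Vec d → Vec k} (hh : Measurable h) :
    eLpNorm (fun z : P2 d × Vec d => bracket h z.1) 2 (ν ⊗ₘ ker d) ≤
      eLpNorm h 2 ((ν ⊗ₘ ker d).map Prod.snd) := by
  have hmeas := measurable_bracket hh
  rw [← ENNReal.pow_le_pow_left_iff two_ne_zero, ← lintegral_enorm_sq, ← lintegral_enorm_sq,
    lintegral_map (by fun_prop) measurable_snd, Measure.lintegral_compProd (by fun_prop),
    Measure.lintegral_compProd (by fun_prop)]
  refine lintegral_mono fun μ => ?_
  simp only [lintegral_const, ker_apply, measure_univ, mul_one]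
  rw [lintegral_enorm_sq]
  gcongr
  calc ‖bracket h μ‖ₑ ≤ ∫⁻ x, ‖h x‖ₑ ∂μ.toMeasure := enorm_integral_le_lintegral_enorm _
    _ = eLpNorm h 1 μ.toMeasure := eLpNorm_one_eq_lintegral_enorm.symm
    _ ≤ eLpNorm h 2 μ.toMeasure :=
      eLpNorm_le_eLpNorm_of_exponent_le (by norm_num) hh.aestronglyMeasurable

/-- A bounded uniformly continuous function is Lipschitz up to an arbitrarily small error. -/
theorem exists_dist_le_add_mul {X E : Type*} [PseudoMetricSpace X] [NormedAddCommGroup E]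
    {G : X → E} (hG : UniformContinuous G) {B : ℝ} (hB : ∀ x, ‖G x‖ ≤ B) {η : ℝ} (hη : 0 < η) :
    ∃ D, 0 < D ∧ ∀ x y, ‖G x - G y‖ ≤ η + D * dist x y := by
  obtain ⟨δ, hδ, h⟩ := Metric.uniformContinuous_iff.1 hG η hη
  refine ⟨(2 * |B| + 1) / δ, by positivity, fun x y => ?_⟩
  by_cases hxy : dist x y < δ
  · have h1 := (h hxy).le
    rw [dist_eq_norm] at h1
    have : 0 ≤ (2 * |B| + 1) / δ * dist x y := by positivity
    linarith
  · have h1 : ‖G x - G y‖ ≤ B + B := (norm_sub_le _ _).trans (add_le_add (hB x) (hB y))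
    have h2 : (2 * |B| + 1) / δ * δ ≤ (2 * |B| + 1) / δ * dist x y := by
      gcongr
      exact not_lt.1 hxy
    rw [div_mul_cancel₀ _ hδ.ne'] at h2
    linarith [le_abs_self B]

/-- The vector of the indicator functions of the sets `A i`. -/
noncomputable def indicators {d k : ℕ} (A : Fin k → Set (Vec d)) (x : Vec d) : Vec k :=
  WithLp.toLp 2 fun i => (A i).indicator 1 x

theorem measurable_indicators {d k : ℕ} {A : Fin k → Set (Vec d)} (hA : ∀ i, MeasurableSet (A i)) :
    Measurable (indicators A) := by
  refine (WithLp.measurable_toLp 2 _).comp (measurable_pi_lambda _ fun i => ?_)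
  exact measurable_one.indicator (hA i)

theorem norm_indicators_le {d k : ℕ} (A : Fin k → Set (Vec d)) (x : Vec d) :
    ‖indicators A x‖ ≤ √k := by
  rw [EuclideanSpace.norm_eq]
  refine Real.sqrt_le_sqrt ?_
  calc ∑ i, ‖indicators A x i‖ ^ 2 ≤ ∑ _ : Fin k, (1 : ℝ) := by
        gcongr with i
        by_cases h : x ∈ A i <;> simp [indicators, h]
    _ = k := by simp

theorem integrable_indicators {d k : ℕ} {A : Fin k → Set (Vec d)} (hA : ∀ i, MeasurableSet (A i))
    (m : Measure (Vec d)) [IsFiniteMeasure m] : Integrable (indicators A) m :=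
  Integrable.of_bound (measurable_indicators hA).aestronglyMeasurable _
    (Eventually.of_forall (norm_indicators_le A))

theorem bracket_indicators {d k : ℕ} {A : Fin k → Set (Vec d)} (hA : ∀ i, MeasurableSet (A i))
    (μ : P2 d) (i : Fin k) : bracket (indicators A) μ i = μ.toMeasure.real (A i) := by
  have h := (EuclideanSpace.proj (𝕜 := ℝ) i : Vec k →L[ℝ] ℝ).integral_comp_comm
    (integrable_indicators hA μ.toMeasure)
  refine h.symm.trans ?_
  simp [indicators, integral_indicator_one (hA i)]

/-- The inverse of `join`, on the coordinates of `ℝᵈ⁺ᵏ`. -/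
def split {d k : ℕ} (v : Vec (d + k)) : Vec d × (Fin k → ℝ) :=
  (WithLp.toLp 2 fun i => v (Fin.castAdd k i), fun i => v (Fin.natAdd d i))

theorem split_join {d k : ℕ} (x : Vec d) (y : Vec k) : split (join x y) = (x, y.ofLp) := by
  ext i <;> simp [split, join]

theorem continuous_split {d k : ℕ} : Continuous (split : Vec (d + k) → _) := by
  unfold split
  fun_prop

theorem measurable_join {d k : ℕ} : Measurable fun q : Vec d × Vec k => join q.1 q.2 := by
  refine (WithLp.measurable_toLp 2 _).comp (measurable_pi_lambda _ fun i => ?_)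
  induction i using Fin.addCases with
  | left i => simp only [Fin.append_left]; fun_prop
  | right i => simp only [Fin.append_right]; fun_prop

theorem IsCylinder.exists_fin {d : ℕ} {E : Type*} [MeasurableSpace E] {g : P2 d × Vec d → E}
    (hg : IsCylinder g) : ∃ (k : ℕ) (A : Fin k → Set (Vec d)), (∀ i, MeasurableSet (A i)) ∧
      ∃ G : Vec d × (Fin k → ℝ) → E, Measurable G ∧ g = G ∘ masses A := by
  obtain ⟨ι, _, A, hA, G, hG, rfl⟩ := hg
  let e := Fintype.equivFin ι
  refine ⟨Fintype.card ι, A ∘ e.symm, fun i => hA _, fun y => G (y.1, fun i => y.2 (e i)),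
    hG.comp (by fun_prop), ?_⟩
  ext1 z
  simp [masses]

/-- `L²` functions are approximated by continuous functions with compact support of `x` and of
finitely many masses. -/
theorem exists_comp_masses_eLpNorm_sub_le {d p : ℕ} (M : Measure (P2 d × Vec d)) [IsFiniteMeasure M]
    {f : P2 d × Vec d → Vec p} (hf : MemLp f 2 M) {ε : ℝ≥0∞} (hε : ε ≠ 0) :
    ∃ (k : ℕ) (A : Fin k → Set (Vec d)) (G : Vec d × (Fin k → ℝ) → Vec p),
      (∀ i, MeasurableSet (A i)) ∧ Continuous G ∧ HasCompactSupport G ∧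
        eLpNorm (f - G ∘ masses A) 2 M ≤ ε := by
  have hε2 : ε / 2 ≠ 0 := by simpa using hε
  obtain ⟨g, hfg, hg⟩ := exists_isCylinder_eLpNorm_sub_le M hf hε2
  obtain ⟨k, A, hA, G, hG, rfl⟩ := hg.exists_fin
  have hmA := measurable_masses hA
  by_cases hεt : ε = ∞
  · exact ⟨k, A, 0, hA, continuous_const, HasCompactSupport.zero, hεt ▸ le_top⟩
  have hGL : MemLp G 2 (M.map (masses A)) := by
    refine (memLp_map_measure_iff hG.aestronglyMeasurable hmA.aemeasurable).2 ?_
    have h1 : MemLp (f - G ∘ masses A) 2 M :=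
      ⟨hf.1.sub (hG.comp hmA).aestronglyMeasurable,
        hfg.trans_lt (ENNReal.div_lt_top hεt two_ne_zero)⟩
    simpa using hf.sub h1
  obtain ⟨G₁, hG₁s, hG₁, hG₁c, -⟩ :=
    hGL.exists_hasCompactSupport_eLpNorm_sub_le (by simp) hε2
  refine ⟨k, A, G₁, hA, hG₁c, hG₁s, ?_⟩
  rw [eLpNorm_map_measure (hG.sub hG₁c.measurable).aestronglyMeasurable hmA.aemeasurable] at hG₁
  have hGm := (hG.comp hmA).aestronglyMeasurable (μ := M)
  have hG₁m := (hG₁c.measurable.comp hmA).aestronglyMeasurable (μ := M)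
  calc eLpNorm (f - G₁ ∘ masses A) 2 M
      = eLpNorm ((f - G ∘ masses A) + (G - G₁) ∘ masses A) 2 M := by
        congr 1; ext1 z; simp
    _ ≤ ε / 2 + ε / 2 :=
        (eLpNorm_add_le (hf.1.sub hGm) (hGm.sub hG₁m) (by norm_num)).trans (add_le_add hfg hG₁)
    _ = ε := ENNReal.add_halves ε

/-- In a continuous function with compact support of `x` and of finitely many masses, the masses can
be replaced by the bracket of a bounded network, which approximates the indicator functions in `L²`
of the mixture `∫ μ ν(dμ)`. -/
theorem exists_network_bracket {σ : ℝ → ℝ} (hσ : IsActivation σ) {d k p : ℕ} (ν : Measure (P2 d))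
    [IsProbabilityMeasure ν] {A : Fin k → Set (Vec d)} (hA : ∀ i, MeasurableSet (A i))
    {G : Vec d × (Fin k → ℝ) → Vec p} (hG : Continuous G) (hGs : HasCompactSupport G) {η : ℝ}
    (hη : 0 < η) :
    ∃ φ : Network d k, Continuous (φ.eval σ) ∧ (∃ C, ∀ x, ‖φ.eval σ x‖ ≤ C) ∧
      eLpNorm (G ∘ masses A - fun z => (G ∘ split) (join z.2 (bracket (φ.eval σ) z.1))) 2
        (ν ⊗ₘ ker d) ≤ ENNReal.ofReal (η + η) := by
  obtain ⟨B, hB⟩ := hGs.exists_bound_of_continuous hG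
  obtain ⟨D, hD, hGD⟩ := exists_dist_le_add_mul (hGs.uniformContinuous_of_continuous hG) hB hη
  have hind := measurable_indicators hA
  have : IsFiniteMeasure ((ν ⊗ₘ ker d).map Prod.snd) := Measure.isFiniteMeasure_map _ _
  obtain ⟨φ, hφ, ⟨C, hC⟩, hφA⟩ := exists_network_eLpNorm_sub_le hσ ((ν ⊗ₘ ker d).map Prod.snd)
    (MemLp.of_bound hind.aestronglyMeasurable _ (Eventually.of_forall (norm_indicators_le A)))
    (ε := ENNReal.ofReal (η / D)) (ENNReal.ofReal_pos.2 (by positivity)).ne'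
  refine ⟨φ, hφ, ⟨C, hC⟩, ?_⟩
  set b : P2 d × Vec d → Vec k := fun z => bracket (indicators A - φ.eval σ) z.1
  have hbm : Measurable b := (measurable_bracket (hind.sub hφ.measurable)).comp measurable_fst
  have hdist : ∀ z : P2 d × Vec d,
      dist (masses A z) (split (join z.2 (bracket (φ.eval σ) z.1))) ≤ ‖b z‖ := by
    intro z
    have hsub : b z = bracket (indicators A) z.1 - bracket (φ.eval σ) z.1 :=
      integral_sub (integrable_indicators hA _)
        (Integrable.of_bound hφ.aestronglyMeasurable C (Eventually.of_forall hC))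
    rw [split_join, masses, Prod.dist_eq, dist_self, max_eq_right dist_nonneg,
      dist_pi_le_iff (norm_nonneg _)]
    intro i
    dsimp only
    rw [← bracket_indicators hA, Real.dist_eq, hsub]
    exact PiLp.norm_apply_le (bracket (indicators A) z.1 - bracket (φ.eval σ) z.1) i
  have hpt : ∀ z : P2 d × Vec d,
      ‖(G ∘ masses A - fun z : P2 d × Vec d => (G ∘ split) (join z.2 (bracket (φ.eval σ) z.1))) z‖
      ≤ ‖(fun _ => η) z + (D • fun z => ‖b z‖) z‖ := by
    intro z
    have h1 : 0 ≤ η + D * ‖b z‖ := by positivity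
    refine (hGD _ _).trans ?_
    simp only [Pi.smul_apply, smul_eq_mul, Real.norm_of_nonneg h1]
    gcongr
    exact hdist z
  calc _ ≤ eLpNorm ((fun _ => η) + D • fun z => ‖b z‖) 2 (ν ⊗ₘ ker d) := eLpNorm_mono hpt
    _ ≤ eLpNorm (fun _ => η) 2 (ν ⊗ₘ ker d) + eLpNorm (D • fun z => ‖b z‖) 2 (ν ⊗ₘ ker d) :=
        eLpNorm_add_le (by fun_prop) (hbm.norm.const_smul D).aestronglyMeasurable (by norm_num)
    _ ≤ ENNReal.ofReal η + ENNReal.ofReal η := by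
        refine add_le_add ?_ ?_
        · rw [eLpNorm_const' _ (by simp) (by simp), ← ofReal_norm, Real.norm_of_nonneg hη.le]
          simp
        · rw [eLpNorm_const_smul, eLpNorm_norm, ← ofReal_norm, Real.norm_of_nonneg hD.le]
          calc ENNReal.ofReal D * eLpNorm b 2 (ν ⊗ₘ ker d)
              ≤ ENNReal.ofReal D * ENNReal.ofReal (η / D) := by
                gcongr
                exact (eLpNorm_bracket_le ν (hind.sub hφ.measurable)).trans hφA
            _ = ENNReal.ofReal η := by
                rw [← ENNReal.ofReal_mul hD.le, mul_div_cancel₀ _ hD.ne']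
    _ = ENNReal.ofReal (η + η) := (ENNReal.ofReal_add hη.le hη.le).symm

end MeanField

open MeanField ProbabilityTheory

/-! ### Assembling the approximations -/

theorem theorem2p2 (σ : ℝ → ℝ) (hσ : MeanField.IsActivation σ) (d p : ℕ)
    (ν : Measure (MeanField.P2 d)) [IsProbabilityMeasure ν]
    (V : MeanField.Vec d → MeanField.P2 d → MeanField.Vec p)
    (hV : Continuous (Function.uncurry V))
    (hV2 : ∫⁻ μ, MeanField.sqNorm (fun x => V x μ) μ ∂ν < ∞)
    (ε : ℝ) (hε : 0 < ε) :
    ∃ (k : ℕ) (Ψ : MeanField.Network (d + k) p) (φ : MeanField.Network d k),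
      (∀ μ : MeanField.P2 d, Integrable (φ.eval σ) μ.toMeasure) ∧
      ∫⁻ μ, MeanField.sqNorm
          (fun x => V x μ - Ψ.eval σ (MeanField.join x (MeanField.bracket (φ.eval σ) μ))) μ ∂ν
        ≤ ENNReal.ofReal ε := by
  set M := ν ⊗ₘ ker d with hM
  let W : P2 d × Vec d → Vec p := fun z => V z.2 z.1
  have hW : Measurable W := by
    have : Continuous W := hV.comp continuous_swap
    exact this.measurable
  have hsq : ∀ F : P2 d × Vec d → Vec p, Measurable F →
      ∫⁻ μ, sqNorm (fun x => F (μ, x)) μ ∂ν = eLpNorm F 2 M ^ 2 := by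
    intro F hF
    rw [← lintegral_enorm_sq, hM, Measure.lintegral_compProd (by fun_prop)]
    rfl
  have hWL : MemLp W 2 M := by
    refine ⟨hW.aestronglyMeasurable, ?_⟩
    rw [hsq W hW] at hV2
    simpa using hV2
  have he : 0 < √ε / 4 := by positivity
  have he0 : ENNReal.ofReal (√ε / 4) ≠ 0 := (ENNReal.ofReal_pos.2 he).ne'
  obtain ⟨k, A, G, hA, hG, hGs, hWG⟩ := exists_comp_masses_eLpNorm_sub_le M hWL he0
  obtain ⟨φ, hφ, ⟨C, hC⟩, hφG⟩ := exists_network_bracket hσ ν hA hG hGs he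
  set J : P2 d × Vec d → Vec (d + k) := fun z => join z.2 (bracket (φ.eval σ) z.1)
  have hJ : Measurable J :=
    measurable_join.comp (measurable_snd.prodMk
      ((measurable_bracket hφ.measurable).comp measurable_fst))
  obtain ⟨B, hB⟩ := hGs.exists_bound_of_continuous hG
  have hGc : Continuous (G ∘ split) := hG.comp continuous_split
  have : IsFiniteMeasure (M.map J) := Measure.isFiniteMeasure_map _ _
  obtain ⟨Ψ, hΨ, -, hΨG⟩ := exists_network_eLpNorm_sub_le hσ (M.map J)
    (MemLp.of_bound hGc.aestronglyMeasurable B (Filter.Eventually.of_forall fun v => hB _)) he0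
  rw [eLpNorm_map_measure (hGc.sub hΨ).aestronglyMeasurable hJ.aemeasurable] at hΨG
  refine ⟨k, Ψ, φ, fun μ =>
    Integrable.of_bound hφ.aestronglyMeasurable C (Filter.Eventually.of_forall hC), ?_⟩
  have hm₁ : Measurable (G ∘ masses A) := hG.measurable.comp (measurable_masses hA)
  have hm₂ : Measurable (G ∘ split ∘ J) := hGc.measurable.comp hJ
  have hm₃ : Measurable (Ψ.eval σ ∘ J) := hΨ.measurable.comp hJ
  have htotal : eLpNorm (W - Ψ.eval σ ∘ J) 2 M ≤ ENNReal.ofReal √ε :=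
    calc eLpNorm (W - Ψ.eval σ ∘ J) 2 M
        = eLpNorm ((W - G ∘ masses A) +
            ((G ∘ masses A - G ∘ split ∘ J) + (G ∘ split - Ψ.eval σ) ∘ J)) 2 M := by
          congr 1; ext1 z; simp
      _ ≤ ENNReal.ofReal (√ε / 4) +
            (ENNReal.ofReal (√ε / 4 + √ε / 4) + ENNReal.ofReal (√ε / 4)) := by
          refine (eLpNorm_add_le (hW.sub hm₁).aestronglyMeasurable
            ((hm₁.sub hm₂).add (hm₂.sub hm₃)).aestronglyMeasurable (by norm_num)).trans
            (add_le_add hWG ?_)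
          exact (eLpNorm_add_le (hm₁.sub hm₂).aestronglyMeasurable
            (hm₂.sub hm₃).aestronglyMeasurable (by norm_num)).trans (add_le_add hφG hΨG)
      _ = ENNReal.ofReal √ε := by
          rw [← ENNReal.ofReal_add (by positivity) he.le, ← ENNReal.ofReal_add he.le (by positivity)]
          congr 1; ring
  calc _ = eLpNorm (W - Ψ.eval σ ∘ J) 2 M ^ 2 := hsq _ (hW.sub hm₃)
    _ ≤ ENNReal.ofReal √ε ^ 2 := by gcongr
    _ = ENNReal.ofReal ε := by
        rw [← ENNReal.ofReal_pow (by positivity), Real.sq_sqrt hε.le]
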